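/- Fix $\ell\ge 1$. For each $m\in\mathbb N$ let $k_i=k_i(m)$ and $n_i=n_i(m)$, $1\le i\le\ell$, be block dimensions, put $k=k_m=\sum_i k_i$ and $n=n_m=\sum_i n_i$, and write $w=(w_1,\dots,w_\ell)\in\mathbb R^{k}$, $u=(u_1,\dots,u_\ell)\in\mathbb R^{n}$ with $w_i\in\mathbb R^{k_i}$, $u_i\in\mathbb R^{n_i}$. Let $G_i\in\mathbb R^{n_i\times k_i}$, $g_i\in\mathbb R^{k_i}$, $h_i\in\mathbb R^{n_i}$, $1\le i\le\ell$, be random, all of them independent, with independent standard Gaussian entries (for each $m$). Let $S_w\subset\mathbb R^{k}$ and $S_u\subset\mathbb R^{n}$ be nonempty, convex and compact, and let $\psi:\mathbb R^{k}\times\mathbb R^{n}\to\mathbb R$ be a (deterministic) function that is continuous on $S_w\times S_u$ and there convex in $w$ and concave in $u$; all these objects may depend on $m$. Define the primary optimal cost $$\Phi_m=\min_{w\in S_w}\max_{u\in S_u}\ \sum_{i=1}^{\ell}u_i^\top G_iw_i+\psi(w,u)$$ and, for $A\subseteq S_w$, the auxiliary optimal cost $$\phi_m(A)=\min_{w\in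 A}\max_{u\in S_u}\ \sum_{i=1}^{\ell}\|u_i\|\,g_i^\top w_i+\sum_{i=1}^{\ell}\|w_i\|\,h_i^\top u_i+\psi(w,u),$$ where $\|\cdot\|$ is the Euclidean norm. For each $m$ let $\mathcal S_m\subseteq\mathbb R^{k}$ be an open set. Put $\phi_m=\phi_m(S_w)$ and $\phi^c_m=\phi_m(S_w\setminus\mathcal S_m)$. Suppose that there are constants $\phi,\phi^c\in\mathbb R$ and $\zeta>0$ such that, as $m\to\infty$, 1. $\phi_m\to\phi$ in probability, 2. $\phi^c_m\to\phi^c$ in probability, 3. $\phi^c\ge\phi+\zeta$. Then, as $m\to\infty$, $|\Phi_m-\phi_m|\to0$ in probability, and with probability tending to $1$ every optimal solution $w$ of the primary problem lies in $\mathcal S_m$ (and there is one); in particular $\mathbb P(\widehat w_m\in\mathcal S_m)\to1$ for every choice $\widehat w_m$ of an optimal solution of the primary problem. (No growth condition on the dimensions is needed; the case of interest is $k_m\to\infty$.) -/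

import Mathlib

open MeasureTheory ProbabilityTheory Filter Topology
open scoped Matrix

namespace MCGMT

/-- Vectors that are concatenations of `ℓ` blocks, the `i`-th block lying in the Euclidean space
of dimension `d i`. -/
abbrev BlockVec {ℓ : ℕ} (d : Fin ℓ → ℕ) : Type :=
  ∀ i, EuclideanSpace ℝ (Fin (d i))

/-- Families of `ℓ` matrices, the `i`-th one of size `n i × k i`. -/
abbrev BlockMat {ℓ : ℕ} (n k : Fin ℓ → ℕ) : Type :=
  ∀ i, Matrix (Fin (n i)) (Fin (k i)) ℝ

/-- The objective `∑ i, uᵢᵀ Gᵢ wᵢ + ψ(w, u)` of the primary problem. -/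
noncomputable def poCost {ℓ : ℕ} {n k : Fin ℓ → ℕ} (ψ : BlockVec k → BlockVec n → ℝ)
    (G : BlockMat n k) (w : BlockVec k) (u : BlockVec n) : ℝ :=
  ∑ i, (u i).ofLp ⬝ᵥ (G i *ᵥ (w i).ofLp) + ψ w u

/-- The objective `∑ i, ‖uᵢ‖ gᵢᵀ wᵢ + ∑ i, ‖wᵢ‖ hᵢᵀ uᵢ + ψ(w, u)` of the auxiliary problem. -/
noncomputable def aoCost {ℓ : ℕ} {n k : Fin ℓ → ℕ} (ψ : BlockVec k → BlockVec n → ℝ)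
    (g : BlockVec k) (h : BlockVec n) (w : BlockVec k) (u : BlockVec n) : ℝ :=
  ∑ i, ‖u i‖ * inner ℝ (g i) (w i) + ∑ i, ‖w i‖ * inner ℝ (h i) (u i) + ψ w u

/-- The optimal cost `min_{w ∈ A} max_{u ∈ B} F w u`. (For nonempty compact `A`, `B` and `F`
continuous on `A × B`, the infimum and the suprema are attained.) -/
noncomputable def minMax {X Y : Type*} (A : Set X) (B : Set Y) (F : X → Y → ℝ) : ℝ :=
  ⨅ w : A, ⨆ u : B, F w u

/-- The set of optimal solutions `w ∈ A` of `min_{w ∈ A} max_{u ∈ B} F w u`. -/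
def optSol {X Y : Type*} (A : Set X) (B : Set Y) (F : X → Y → ℝ) : Set X :=
  {w | w ∈ A ∧ IsMinOn (fun w => ⨆ u : B, F w u) A w}

/-- The family of all the scalar entries of the matrices `Gᵢ`, the vectors `gᵢ` and the
vectors `hᵢ`, for random `G`, `g`, `h`. -/
def entries {ℓ : ℕ} {n k : Fin ℓ → ℕ} {Ω : Type*} (G : Ω → BlockMat n k)
    (g : Ω → BlockVec k) (h : Ω → BlockVec n) :
    (Σ i, Fin (n i) × Fin (k i)) ⊕ (Σ i, Fin (k i)) ⊕ (Σ i, Fin (n i)) → Ω → ℝ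
  | .inl ⟨i, a, b⟩ => fun ω => G ω i a b
  | .inr (.inl ⟨i, b⟩) => fun ω => g ω i b
  | .inr (.inr ⟨i, a⟩) => fun ω => h ω i a

/-- All the entries of all the `Gᵢ`, `gᵢ` and `hᵢ` are jointly independent standard Gaussian
random variables. -/
def IsStdGaussian {ℓ : ℕ} {n k : Fin ℓ → ℕ} {Ω : Type*} [MeasurableSpace Ω]
    (P : Measure Ω) (G : Ω → BlockMat n k) (g : Ω → BlockVec k) (h : Ω → BlockVec n) : Prop :=
  (∀ j, HasLaw (entries G g h j) (gaussianReal 0 1) P) ∧ iIndepFun (entries G g h) P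

end MCGMT

/-! Up to the deterministic ψ, both objectives are centred Gaussian processes indexed by (w, u), and
Gordon's min-max comparison relates them. Add ∑ ‖wᵢ‖‖uᵢ‖γᵢ to the primary process, with fresh
standard Gaussians γᵢ. The primary covariance minus the auxiliary one is then ∑ (‖uᵢ‖‖uᵢ'‖ − ⟨uᵢ,
uᵢ'⟩)(‖wᵢ‖‖wᵢ'‖ − ⟨wᵢ, wᵢ'⟩), which is nonnegative and vanishes when w = w'. Gordon's inequality
(`gordon_countable_lt`, proved by interpolation and Gaussian integration by parts) bounds the lower
tail of the extended primary cost by that of the auxiliary cost. Restricting to γᵢ ≤ 0 for all i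
removes the extra terms at the price of a factor 2^ℓ. This gives `measure_minMax_poCost_lt_le`,
which needs no convexity.

For upper tails, Sion's theorem turns −Φ into the optimal cost of the problem with the players
exchanged, which has the same form with data −Gᵀ, −h, −g. The auxiliary objective is not
convex-concave in general, but weak duality suffices for it and points the right way:
`measure_lt_minMax_poCost_le`.

As 2^ℓ does not depend on m, φ_m → φ forces Φ_m → φ. The lower-tail bound on the compact, possibly
nonconvex set `Sw \ S` keeps the primary cost there at least φc − ζ/3 > φ + ζ/3 with high
probability, so no optimal solution lies outside S. -/

namespace MCGMT

/-! ### Gaussian integration by parts. -/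

section Stein

/-- Gaussian integration by parts on the line. -/
lemma integral_id_mul_gaussianReal {H H' : ℝ → ℝ} {C : ℝ}
    (hder : ∀ x, HasDerivAt H (H' x) x) (hH'c : Continuous H')
    (hH : ∀ x, |H x| ≤ C) (hH' : ∀ x, |H' x| ≤ C) :
    ∫ x, x * H x ∂gaussianReal 0 1 = ∫ x, H' x ∂gaussianReal 0 1 := by
  have hHc : Continuous H := continuous_iff_continuousAt.2 fun x => (hder x).continuousAt
  -- The density p satisfies p' = −x p, so the claim is ordinary integration by parts against p.
  have hpdf : ∀ x, HasDerivAt (gaussianPDFReal 0 1) (-x * gaussianPDFReal 0 1 x) x := by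
    intro x
    have h1 : HasDerivAt (fun y : ℝ => -(y - 0) ^ 2 / (2 * ((1 : NNReal) : ℝ))) (-x) x := by
      have := (((hasDerivAt_id x).sub_const 0).pow 2).neg.div_const (2 * ((1 : NNReal) : ℝ))
      refine this.congr_deriv ?_
      simp only [id, sub_zero, NNReal.coe_one]
      norm_num
      ring
    have := (h1.exp).const_mul ((√(2 * Real.pi * ((1 : NNReal) : ℝ)))⁻¹)
    rw [gaussianPDFReal_def]
    refine this.congr_deriv ?_
    ring
  have hint : Integrable (gaussianPDFReal 0 1) := integrable_gaussianPDFReal 0 1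
  have hint' : Integrable (fun x => gaussianPDFReal 0 1 x * x) := by
    have h : Integrable (fun x : ℝ => x) (gaussianReal 0 1) :=
      (memLp_id_gaussianReal' (μ := 0) (v := 1) 1 (by simp)).integrable le_rfl
    rw [gaussianReal_of_var_ne_zero _ one_ne_zero,
      integrable_withDensity_iff (by fun_prop) (.of_forall fun _ => gaussianPDF_lt_top)] at h
    simpa [toReal_gaussianPDF, mul_comm] using h
  have key := integral_mul_deriv_eq_deriv_mul_of_integrable (u := H) (u' := H')
    (v := gaussianPDFReal 0 1) (v' := fun x => -x * gaussianPDFReal 0 1 x)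
    (fun x _ => hder x) (fun x _ => hpdf x)
    (by
      have := (hint'.bdd_mul (c := C) hHc.aestronglyMeasurable (.of_forall hH)).neg
      refine this.congr (.of_forall fun x => ?_)
      simp only [Pi.neg_apply, Pi.mul_apply]; ring)
    (hint.bdd_mul (c := C) hH'c.aestronglyMeasurable (.of_forall hH'))
    (hint.bdd_mul (c := C) hHc.aestronglyMeasurable (.of_forall hH))
  rw [integral_gaussianReal_eq_integral_smul one_ne_zero,
    integral_gaussianReal_eq_integral_smul one_ne_zero]
  simp only [smul_eq_mul]
  have e1 : ∀ x, gaussianPDFReal 0 1 x * (x * H x) = - (H x * (-x * gaussianPDFReal 0 1 x)) :=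
    fun x => by ring
  simp_rw [e1, integral_neg, key, neg_neg, mul_comm]

variable {κ : Type*} [Fintype κ]

/-- The standard Gaussian measure on `κ → ℝ`. -/
noncomputable def stdGaussianPi (κ : Type*) [Fintype κ] : Measure (κ → ℝ) :=
  Measure.pi fun _ => gaussianReal 0 1

instance : IsProbabilityMeasure (stdGaussianPi κ) := by
  unfold stdGaussianPi; infer_instance

/-- Resampling one coordinate preserves a product of probability measures. -/
lemma measurePreserving_update [DecidableEq κ] (p : κ) :
    MeasurePreserving (fun q : (κ → ℝ) × ℝ => Function.update q.1 p q.2)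
      ((stdGaussianPi κ).prod (gaussianReal 0 1)) (stdGaussianPi κ) where
  measurable := by
    refine measurable_pi_iff.2 fun a => ?_
    by_cases h : a = p
    · subst h; simpa using measurable_snd
    · simp only [Function.update_of_ne h]; fun_prop
  map_eq := by
    symm
    have hm : Measurable (fun q : (κ → ℝ) × ℝ => Function.update q.1 p q.2) := by
      refine measurable_pi_iff.2 fun a => ?_
      by_cases h : a = p
      · subst h; simpa using measurable_snd
      · simp only [Function.update_of_ne h]; fun_prop
    refine Measure.pi_eq fun s hs => ?_
    rw [Measure.map_apply hm (MeasurableSet.univ_pi hs)]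
    have : (fun q : (κ → ℝ) × ℝ => Function.update q.1 p q.2) ⁻¹' Set.univ.pi s
        = (Set.univ.pi (Function.update s p Set.univ)) ×ˢ s p := by
      ext ⟨z, x⟩
      simp only [Set.mem_preimage, Set.mem_univ_pi, Set.mem_prod]
      constructor
      · intro h
        refine ⟨fun a => ?_, by simpa using h p⟩
        by_cases hap : a = p
        · subst hap; simp
        · simpa [hap] using h a
      · rintro ⟨h1, h2⟩ a
        by_cases hap : a = p
        · subst hap; simpa using h2
        · simpa [hap] using h1 a
    rw [this, Measure.prod_prod, stdGaussianPi, Measure.pi_pi,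
      ← Finset.mul_prod_erase Finset.univ _ (Finset.mem_univ p),
      ← Finset.mul_prod_erase Finset.univ (fun i => gaussianReal 0 1 (s i)) (Finset.mem_univ p)]
    simp only [Function.update_self, measure_univ, one_mul]
    rw [mul_comm]
    congr 1
    refine Finset.prod_congr rfl fun a ha => ?_
    rw [Function.update_of_ne (Finset.ne_of_mem_erase ha)]

lemma integrable_eval_stdGaussianPi (p : κ) :
    Integrable (fun z : κ → ℝ => z p) (stdGaussianPi κ) := by
  have h : Integrable (fun x : ℝ => x) (gaussianReal 0 1) :=
    (memLp_id_gaussianReal' (μ := 0) (v := 1) 1 (by simp)).integrable le_rfl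
  exact (measurePreserving_eval (fun _ : κ => gaussianReal 0 1) p).integrable_comp_of_integrable h

/-- Gaussian integration by parts in one coordinate of a standard Gaussian vector. -/
lemma integral_eval_mul_stdGaussianPi [DecidableEq κ] (p : κ) {H H' : (κ → ℝ) → ℝ} {C : ℝ}
    (hder : ∀ z x, HasDerivAt (fun y => H (Function.update z p y))
      (H' (Function.update z p x)) x)
    (hHc : Continuous H) (hH'c : Continuous H') (hH : ∀ z, |H z| ≤ C) (hH' : ∀ z, |H' z| ≤ C) :
    ∫ z, z p * H z ∂stdGaussianPi κ = ∫ z, H' z ∂stdGaussianPi κ := by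
  have mp := measurePreserving_update p
  have hi1 : Integrable (fun z : κ → ℝ => z p * H z) (stdGaussianPi κ) :=
    (integrable_eval_stdGaussianPi p).mul_bdd (c := C) hHc.aestronglyMeasurable (.of_forall hH)
  have hi2 : Integrable H' (stdGaussianPi κ) :=
    Integrable.of_bound hH'c.aestronglyMeasurable C (.of_forall hH')
  have hu : ∀ z : κ → ℝ, Continuous (fun x : ℝ => Function.update z p x) := fun z => by fun_prop
  -- Resampling coordinate p and applying Fubini leaves a one-dimensional integral with the other
  -- coordinates frozen.
  have key : ∀ {F : (κ → ℝ) → ℝ}, Integrable F (stdGaussianPi κ) →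
      ∫ z, F z ∂stdGaussianPi κ
        = ∫ z, ∫ x, F (Function.update z p x) ∂gaussianReal 0 1 ∂stdGaussianPi κ := by
    intro F hF
    conv_lhs => rw [← mp.map_eq]
    rw [integral_map mp.measurable.aemeasurable (by rw [mp.map_eq]; exact hF.1)]
    exact integral_prod _ (mp.integrable_comp_of_integrable hF)
  rw [key hi1, key hi2]
  congr 1
  ext z
  simp only [Function.update_self]
  exact integral_id_mul_gaussianReal (hder z) (hH'c.comp (hu z)) (fun x => hH _) (fun x => hH' _)

end Stein

/-! ### Gaussian interpolation. -/

section Interpolation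

variable {κ α : Type*} [Fintype κ] [Fintype α]

/-- `f` has partial derivatives `f₁ a`, in the form of a chain rule along curves. -/
def HasPartials (f : (α → ℝ) → ℝ) (f₁ : α → (α → ℝ) → ℝ) : Prop :=
  ∀ (x : ℝ → α → ℝ) (x' : α → ℝ) (t : ℝ), (∀ a, HasDerivAt (fun s => x s a) (x' a) t) →
    HasDerivAt (fun s => f (x s)) (∑ a, f₁ a (x t) * x' a) t

/-- The derivative of a Gaussian expectation along a smooth path of covariance factors. -/
lemma hasDerivAt_integral_gaussian {f : (α → ℝ) → ℝ} {f₁ : α → (α → ℝ) → ℝ}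
    {f₂ : α → α → (α → ℝ) → ℝ} {C : ℝ}
    (h₁ : HasPartials f f₁) (h₂ : ∀ a, HasPartials (f₁ a) (f₂ a))
    (hfc : Continuous f) (hf₁c : ∀ a, Continuous (f₁ a)) (hf₂c : ∀ a b, Continuous (f₂ a b))
    (hfC : ∀ x, |f x| ≤ C) (hf₁C : ∀ a x, |f₁ a x| ≤ C) (hf₂C : ∀ a b x, |f₂ a b x| ≤ C)
    {v v' : ℝ → α → κ → ℝ} (hv : ∀ t a p, HasDerivAt (fun s => v s a p) (v' t a p) t)
    {K : ℝ} (hv' : ∀ t a p, |v' t a p| ≤ K) (t : ℝ) :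
    HasDerivAt (fun s => ∫ z, f (fun a => v s a ⬝ᵥ z) ∂stdGaussianPi κ)
      (∑ a, ∑ b, (v' t a ⬝ᵥ v t b) * ∫ z, f₂ a b (fun a => v t a ⬝ᵥ z) ∂stdGaussianPi κ) t := by
  classical
  have hcont : ∀ s, Continuous (fun (z : κ → ℝ) a => v s a ⬝ᵥ z) := fun s =>
    continuous_pi fun a => by unfold dotProduct; fun_prop
  have hC : ∀ a, 0 ≤ C := fun a => (abs_nonneg _).trans (hf₁C a 0)
  have hd : ∀ z s a, HasDerivAt (fun s => v s a ⬝ᵥ z) (v' s a ⬝ᵥ z) s := by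
    intro z s a
    unfold dotProduct
    exact HasDerivAt.fun_sum fun p _ => (hv s a p).mul_const (z p)
  have key := hasDerivAt_integral_of_dominated_loc_of_deriv_le (μ := stdGaussianPi κ)
    (F := fun s z => f (fun a => v s a ⬝ᵥ z)) (x₀ := t) (s := Set.univ)
    (F' := fun s z => ∑ a, f₁ a (fun a => v s a ⬝ᵥ z) * (v' s a ⬝ᵥ z))
    (bound := fun z => ∑ a : α, C * ∑ p, K * |z p|)
    Filter.univ_mem (.of_forall fun s => (hfc.comp (hcont s)).aestronglyMeasurable)
    (Integrable.of_bound (hfc.comp (hcont t)).aestronglyMeasurable C (.of_forall fun z => hfC _))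
    (by
      refine Continuous.aestronglyMeasurable (continuous_finsetSum _ fun a _ => ?_)
      refine ((hf₁c a).comp (hcont t)).mul ?_
      unfold dotProduct; fun_prop)
    (.of_forall fun z s _ => by
      refine (norm_sum_le _ _).trans (Finset.sum_le_sum fun a _ => ?_)
      rw [norm_mul]
      refine mul_le_mul (hf₁C a _) ?_ (norm_nonneg _) (hC a)
      refine (norm_sum_le _ _).trans (Finset.sum_le_sum fun p _ => ?_)
      rw [norm_mul]
      exact mul_le_mul_of_nonneg_right (hv' s a p) (abs_nonneg _))
    (integrable_finsetSum _ fun a _ => (integrable_finsetSum _ fun p _ =>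
      (integrable_eval_stdGaussianPi p).abs.const_mul K).const_mul C)
    (.of_forall fun z s _ => h₁ (fun s a => v s a ⬝ᵥ z) (fun a => v' s a ⬝ᵥ z) s (hd z s))
  refine key.2.congr_deriv ?_
  have hint : ∀ a p, Integrable (fun z : κ → ℝ => z p * f₁ a (fun a => v t a ⬝ᵥ z))
      (stdGaussianPi κ) := fun a p =>
    (integrable_eval_stdGaussianPi p).mul_bdd (c := C)
      ((hf₁c a).comp (hcont t)).aestronglyMeasurable (.of_forall fun z => hf₁C a _)
  have hint₂ : ∀ a b, Integrable (fun z : κ → ℝ => f₂ a b (fun a => v t a ⬝ᵥ z))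
      (stdGaussianPi κ) := fun a b =>
    Integrable.of_bound ((hf₂c a b).comp (hcont t)).aestronglyMeasurable C
      (.of_forall fun z => hf₂C a b _)
  -- Integration by parts trades the factor z p for a derivative in direction p, which by the chain
  -- rule produces the second partials.
  have stein : ∀ a p, ∫ z, z p * f₁ a (fun a => v t a ⬝ᵥ z) ∂stdGaussianPi κ
      = ∑ b, (∫ z, f₂ a b (fun a => v t a ⬝ᵥ z) ∂stdGaussianPi κ) * v t b p := by
    intro a p
    rw [integral_eval_mul_stdGaussianPi p (H := fun z => f₁ a (fun a => v t a ⬝ᵥ z))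
      (H' := fun z => ∑ b, f₂ a b (fun a => v t a ⬝ᵥ z) * v t b p)
      (C := max C (∑ b, C * |v t b p|)) ?_ ((hf₁c a).comp (hcont t)) ?_
      (fun z => (hf₁C a _).trans (le_max_left _ _)) ?_]
    · rw [integral_finsetSum _ fun b _ => (hint₂ a b).mul_const _]
      simp_rw [integral_mul_const]
    · intro z x
      refine h₂ a (fun y b => v t b ⬝ᵥ Function.update z p y) (fun b => v t b p) x fun b => ?_
      have : ∀ y, v t b ⬝ᵥ Function.update z p y
          = v t b p * y + ∑ q ∈ Finset.univ.erase p, v t b q * z q := by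
        intro y
        rw [dotProduct, ← Finset.add_sum_erase _ _ (Finset.mem_univ p), Function.update_self]
        congr 1
        exact Finset.sum_congr rfl fun q hq => by
          rw [Function.update_of_ne (Finset.ne_of_mem_erase hq)]
      simp_rw [this]
      simpa using ((hasDerivAt_id x).const_mul (v t b p)).add_const
        (∑ q ∈ Finset.univ.erase p, v t b q * z q)
    · exact continuous_finsetSum _ fun b _ => ((hf₂c a b).comp (hcont t)).mul_const _
    · intro z
      refine le_trans ?_ (le_max_right _ _)
      refine (Finset.abs_sum_le_sum_abs _ _).trans (Finset.sum_le_sum fun b _ => ?_)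
      rw [abs_mul]
      exact mul_le_mul_of_nonneg_right (hf₂C a b _) (abs_nonneg _)
  have e : ∀ z : κ → ℝ, ∑ a, f₁ a (fun a => v t a ⬝ᵥ z) * (v' t a ⬝ᵥ z)
      = ∑ a, ∑ p, v' t a p * (z p * f₁ a (fun a => v t a ⬝ᵥ z)) := by
    intro z
    refine Finset.sum_congr rfl fun a _ => ?_
    rw [dotProduct, Finset.mul_sum]
    exact Finset.sum_congr rfl fun p _ => by ring
  simp_rw [e]
  rw [integral_finsetSum _ fun a _ => integrable_finsetSum _ fun p _ => (hint a p).const_mul _]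
  refine Finset.sum_congr rfl fun a _ => ?_
  rw [integral_finsetSum _ fun p _ => (hint a p).const_mul _]
  simp_rw [integral_const_mul, stein, Finset.mul_sum]
  rw [Finset.sum_comm]
  refine Finset.sum_congr rfl fun b _ => ?_
  rw [dotProduct, Finset.sum_mul]
  exact Finset.sum_congr rfl fun p _ => by ring

/-- Comparison of Gaussian expectations by rotating one family of vectors into an orthogonal
one. -/
lemma integral_gaussian_le_of_partials {f : (α → ℝ) → ℝ} {f₁ : α → (α → ℝ) → ℝ}
    {f₂ : α → α → (α → ℝ) → ℝ} {C : ℝ}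
    (h₁ : HasPartials f f₁) (h₂ : ∀ a, HasPartials (f₁ a) (f₂ a))
    (hfc : Continuous f) (hf₁c : ∀ a, Continuous (f₁ a)) (hf₂c : ∀ a b, Continuous (f₂ a b))
    (hfC : ∀ x, |f x| ≤ C) (hf₁C : ∀ a x, |f₁ a x| ≤ C) (hf₂C : ∀ a b x, |f₂ a b x| ≤ C)
    {X Y : α → κ → ℝ} (horth : ∀ a b, Y a ⬝ᵥ X b = 0)
    (hcov : ∀ a b, X a ⬝ᵥ X b ≤ Y a ⬝ᵥ Y b)
    (hsign : ∀ a b, X a ⬝ᵥ X b = Y a ⬝ᵥ Y b ∨ ∀ x, 0 ≤ f₂ a b x) :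
    ∫ z, f (fun a => X a ⬝ᵥ z) ∂stdGaussianPi κ
      ≤ ∫ z, f (fun a => Y a ⬝ᵥ z) ∂stdGaussianPi κ := by
  -- A quarter turn from X at t = 0 to Y at t = π/2. As X ⟂ Y, the covariance along the path is sin²
  -- t · cov Y + cos² t · cov X.
  set v : ℝ → α → κ → ℝ := fun t a => Real.sin t • Y a + Real.cos t • X a with hvdef
  set v' : ℝ → α → κ → ℝ := fun t a => Real.cos t • Y a - Real.sin t • X a with hv'def
  have hv : ∀ t a p, HasDerivAt (fun s => v s a p) (v' t a p) t := by
    intro t a p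
    simp only [hvdef, hv'def, Pi.add_apply, Pi.sub_apply, Pi.smul_apply, smul_eq_mul]
    refine (((Real.hasDerivAt_sin t).mul_const (Y a p)).add
      ((Real.hasDerivAt_cos t).mul_const (X a p))).congr_deriv ?_
    ring
  set K : ℝ := ∑ a, ∑ p, (|Y a p| + |X a p|) with hK
  have hv' : ∀ t a p, |v' t a p| ≤ K := by
    intro t a p
    have h1 : |v' t a p| ≤ |Y a p| + |X a p| := by
      simp only [hv'def, Pi.sub_apply, Pi.smul_apply, smul_eq_mul]
      refine (abs_sub _ _).trans ?_
      rw [abs_mul, abs_mul]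
      exact add_le_add (mul_le_of_le_one_left (abs_nonneg _) (Real.abs_cos_le_one t))
        (mul_le_of_le_one_left (abs_nonneg _) (Real.abs_sin_le_one t))
    refine h1.trans ?_
    refine (Finset.single_le_sum (f := fun p => |Y a p| + |X a p|)
      (fun _ _ => by positivity) (Finset.mem_univ p)).trans ?_
    exact Finset.single_le_sum (f := fun a => ∑ p, (|Y a p| + |X a p|))
      (fun _ _ => by positivity) (Finset.mem_univ a)
  have hder := hasDerivAt_integral_gaussian h₁ h₂ hfc hf₁c hf₂c hfC hf₁C hf₂C hv hv'
  have hmono : MonotoneOn (fun s => ∫ z, f (fun a => v s a ⬝ᵥ z) ∂stdGaussianPi κ)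
      (Set.Icc 0 (Real.pi / 2)) := by
    refine monotoneOn_of_deriv_nonneg (convex_Icc _ _)
      (fun t _ => (hder t).continuousAt.continuousWithinAt)
      (fun t _ => (hder t).differentiableAt.differentiableWithinAt) fun t ht => ?_
    rw [interior_Icc] at ht
    rw [(hder t).deriv]
    refine Finset.sum_nonneg fun a _ => Finset.sum_nonneg fun b _ => ?_
    have e : v' t a ⬝ᵥ v t b = Real.sin t * Real.cos t * (Y a ⬝ᵥ Y b - X a ⬝ᵥ X b) := by
      simp only [hvdef, hv'def, sub_dotProduct, dotProduct_add, smul_dotProduct, dotProduct_smul,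
        smul_eq_mul, horth a b, (dotProduct_comm (X a) (Y b)).trans (horth b a)]
      ring
    rw [e]
    -- Each summand of the derivative is nonnegative: either the covariances agree, or the
    -- covariance gap and the second partial are both nonnegative.
    rcases hsign a b with h | h
    · simp [h]
    · have hs : 0 ≤ Real.sin t :=
        Real.sin_nonneg_of_nonneg_of_le_pi ht.1.le (by linarith [ht.2, Real.pi_pos])
      have hc : 0 ≤ Real.cos t :=
        Real.cos_nonneg_of_mem_Icc ⟨by linarith [ht.1, Real.pi_pos], ht.2.le⟩
      exact mul_nonneg (mul_nonneg (mul_nonneg hs hc) (sub_nonneg.2 (hcov a b)))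
        (integral_nonneg fun z => h _)
  have := hmono (Set.left_mem_Icc.2 (by positivity)) (Set.right_mem_Icc.2 (by positivity))
    (by positivity : (0 : ℝ) ≤ Real.pi / 2)
  simpa [hvdef] using this

end Interpolation

/-! ### Smooth approximation of the min-max event. -/

section SmoothMinMax

variable {I J : Type*}

/-- A smooth approximation of the indicator of `x a < L a`. -/
noncomputable def softLt (β c : ℝ) (L : I × J → ℝ) (a : I × J) (x : I × J → ℝ) : ℝ :=
  Real.sigmoid (-(β * (x a - L a) + c))

variable {β c : ℝ} {L : I × J → ℝ}

lemma softLt_mem (a : I × J) (x) : softLt β c L a x ∈ Set.Icc (0 : ℝ) 1 :=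
  ⟨Real.sigmoid_nonneg _, Real.sigmoid_le_one _⟩

lemma continuous_softLt (a : I × J) : Continuous (softLt β c L a) :=
  continuous_sigmoid.comp (by fun_prop)

lemma hasDerivAt_softLt {x : ℝ → I × J → ℝ} {x' : I × J → ℝ} {t : ℝ}
    (hx : ∀ a, HasDerivAt (fun s => x s a) (x' a) t) (a : I × J) :
    HasDerivAt (fun s => softLt β c L a (x s))
      (-β * softLt β c L a (x t) * (1 - softLt β c L a (x t)) * x' a) t := by
  have h := (((((hx a).sub_const (L a)).const_mul β).add_const c).neg)
  have := (Real.hasDerivAt_sigmoid (-(β * (x t a - L a) + c))).comp t h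
  refine this.congr_deriv ?_
  simp only [softLt]
  ring

-- The shift N settles the boundary: at x a = L a the argument is −N, so the limit is 0, as the
-- strict inequality requires. For x a < L a the scale N² beats the shift.
open Classical in
lemma tendsto_softLt (a : I × J) (x : I × J → ℝ) :
    Tendsto (fun N : ℕ => softLt ((N : ℝ) ^ 2) N L a x) atTop
      (𝓝 (if x a < L a then 1 else 0)) := by
  have hN : Tendsto (fun N : ℕ => (N : ℝ)) atTop atTop := tendsto_natCast_atTop_atTop
  split_ifs with h
  · refine Real.tendsto_sigmoid_atTop.comp ?_
    have h1 : Tendsto (fun N : ℕ => (N : ℝ) * (L a - x a) - 1) atTop atTop :=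
      tendsto_atTop_add_const_right _ _ (hN.atTop_mul_const (sub_pos.2 h))
    refine (hN.atTop_mul_atTop₀ h1).congr fun N => ?_
    ring
  · refine Real.tendsto_sigmoid_atBot.comp ?_
    refine tendsto_neg_atTop_atBot.comp (tendsto_atTop_mono (fun N => ?_) hN)
    have := mul_nonneg (sq_nonneg (N : ℝ)) (sub_nonneg.2 (not_lt.1 h))
    linarith

variable [Fintype J]

/-- A smooth approximation of the indicator of `∀ j, x (i, j) < L (i, j)`. -/
noncomputable def softAll (β c : ℝ) (L : I × J → ℝ) (i : I) (x : I × J → ℝ) : ℝ :=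
  ∏ j, softLt β c L (i, j) x

/-- A smooth approximation of the indicator of `∀ i ∈ T, ∃ j, L (i, j) ≤ x (i, j)`. -/
noncomputable def softEx (β c : ℝ) (L : I × J → ℝ) (T : Finset I) (x : I × J → ℝ) : ℝ :=
  ∏ i ∈ T, (1 - softAll β c L i x)

lemma softAll_mem (i : I) (x) : softAll β c L i x ∈ Set.Icc (0 : ℝ) 1 :=
  ⟨Finset.prod_nonneg fun _ _ => (softLt_mem _ _).1,
    Finset.prod_le_one (fun _ _ => (softLt_mem _ _).1) fun _ _ => (softLt_mem _ _).2⟩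

lemma softEx_mem (T : Finset I) (x) : softEx β c L T x ∈ Set.Icc (0 : ℝ) 1 :=
  ⟨Finset.prod_nonneg fun i _ => sub_nonneg.2 (softAll_mem i _).2,
    Finset.prod_le_one (fun i _ => sub_nonneg.2 (softAll_mem i _).2)
      fun i _ => sub_le_self _ (softAll_mem i _).1⟩

lemma continuous_softAll (i : I) : Continuous (softAll β c L i) :=
  continuous_finsetProd _ fun _ _ => continuous_softLt _

lemma continuous_softEx (T : Finset I) : Continuous (softEx β c L T) :=
  continuous_finsetProd _ fun i _ => continuous_const.sub (continuous_softAll i)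

/-- The logistic derivative s(1 − s) returns the factor that the product rule removes, so the full
product reappears. -/
lemma hasDerivAt_softAll {x : ℝ → I × J → ℝ} {x' : I × J → ℝ} {t : ℝ}
    (hx : ∀ a, HasDerivAt (fun s => x s a) (x' a) t) (i : I) :
    HasDerivAt (fun s => softAll β c L i (x s))
      (∑ j, -β * softAll β c L i (x t) * (1 - softLt β c L (i, j) (x t)) * x' (i, j)) t := by
  classical
  have := HasDerivAt.fun_finsetProd (u := Finset.univ)
    (f := fun j s => softLt β c L (i, j) (x s)) fun j _ => hasDerivAt_softLt hx (i, j)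
  refine this.congr_deriv (Finset.sum_congr rfl fun j _ => ?_)
  rw [softAll, ← Finset.mul_prod_erase _ _ (Finset.mem_univ j), smul_eq_mul]
  ring

lemma hasDerivAt_softEx [DecidableEq I] {x : ℝ → I × J → ℝ} {x' : I × J → ℝ} {t : ℝ}
    (hx : ∀ a, HasDerivAt (fun s => x s a) (x' a) t)
    (T : Finset I) :
    HasDerivAt (fun s => softEx β c L T (x s))
      (∑ i ∈ T, ∑ j, β * softEx β c L (T.erase i) (x t) * softAll β c L i (x t)
        * (1 - softLt β c L (i, j) (x t)) * x' (i, j)) t := by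
  have := HasDerivAt.fun_finsetProd (u := T)
    (f := fun i s => 1 - softAll β c L i (x s)) fun i _ => (hasDerivAt_softAll hx i).const_sub 1
  refine this.congr_deriv (Finset.sum_congr rfl fun i _ => ?_)
  rw [smul_eq_mul, ← Finset.sum_neg_distrib, Finset.mul_sum]
  refine Finset.sum_congr rfl fun j _ => ?_
  rw [softEx]
  ring

variable [Fintype I]

/-- First partial derivatives of `softEx β c L univ`. -/
noncomputable def softEx₁ [DecidableEq I] (β c : ℝ) (L : I × J → ℝ) (a : I × J)
    (x : I × J → ℝ) : ℝ :=
  β * softEx β c L (Finset.univ.erase a.1) x * softAll β c L a.1 x * (1 - softLt β c L a x)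

/-- Second partial derivatives of `softEx β c L univ`. -/
noncomputable def softEx₂ [DecidableEq I] [DecidableEq J] (β c : ℝ) (L : I × J → ℝ)
    (a b : I × J) (x : I × J → ℝ) : ℝ :=
  (if b.1 ∈ Finset.univ.erase a.1 then
    β ^ 2 * softEx β c L ((Finset.univ.erase a.1).erase b.1) x * softAll β c L b.1 x
      * (1 - softLt β c L b x) * softAll β c L a.1 x * (1 - softLt β c L a x) else 0)
  + (if b.1 = a.1 then
    - (β ^ 2 * softEx β c L (Finset.univ.erase a.1) x * softAll β c L a.1 x
      * (1 - softLt β c L b x) * (1 - softLt β c L a x)) else 0)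
  + (if b = a then
    β ^ 2 * softEx β c L (Finset.univ.erase a.1) x * softAll β c L a.1 x
      * softLt β c L a x * (1 - softLt β c L a x) else 0)

lemma hasPartials_softEx [DecidableEq I] :
    HasPartials (softEx β c L Finset.univ) (softEx₁ β c L) := by
  intro x x' t hx
  refine (hasDerivAt_softEx hx Finset.univ).congr_deriv ?_
  rw [Fintype.sum_prod_type]
  rfl

lemma hasPartials_softEx₁ [DecidableEq I] [DecidableEq J] (a : I × J) :
    HasPartials (softEx₁ β c L a) (softEx₂ β c L a) := by
  intro x x' t hx
  have := (((hasDerivAt_softEx (β := β) (c := c) (L := L) hx (Finset.univ.erase a.1)).const_mul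
    β).mul (hasDerivAt_softAll (β := β) (c := c) (L := L) hx a.1)).mul
    ((hasDerivAt_softLt (β := β) (c := c) (L := L) hx a).const_sub 1)
  refine this.congr_deriv ?_
  simp only [softEx₂, add_mul, Finset.sum_add_distrib, ite_mul, zero_mul]
  rw [Finset.sum_ite_eq' Finset.univ a, if_pos (Finset.mem_univ a)]
  simp only [Fintype.sum_prod_type]
  have e2 : ∀ i : I, ∀ F : J → ℝ, (∑ j, if i = a.1 then F j else 0)
      = if i = a.1 then ∑ j, F j else 0 := by
    intro i F; split_ifs <;> simp
  have e1 : ∀ i : I, ∀ F : J → ℝ, (∑ j, if i ∈ Finset.univ.erase a.1 then F j else 0)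
      = if i ∈ Finset.univ.erase a.1 then ∑ j, F j else 0 := by
    intro i F; split_ifs <;> simp
  simp only [e1, e2]
  rw [Finset.sum_ite_mem, Finset.univ_inter, Finset.sum_ite_eq' Finset.univ a.1,
    if_pos (Finset.mem_univ _)]
  simp only [Finset.mul_sum, Finset.sum_mul]
  congr 1
  · congr 1
    · refine Finset.sum_congr rfl fun i _ => Finset.sum_congr rfl fun j _ => by ring
    · refine Finset.sum_congr rfl fun j _ => by ring
  · simp only [Pi.mul_apply]
    ring

lemma continuous_softEx₁ [DecidableEq I] (a : I × J) : Continuous (softEx₁ β c L a) :=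
  ((continuous_const.mul (continuous_softEx _)).mul (continuous_softAll _)).mul
    (continuous_const.sub (continuous_softLt _))

lemma continuous_softEx₂ [DecidableEq I] [DecidableEq J] (a b : I × J) :
    Continuous (softEx₂ β c L a b) := by
  have := fun T => continuous_softEx (β := β) (c := c) (L := L) T
  have := fun T => continuous_softAll (β := β) (c := c) (L := L) T
  have := fun T => continuous_softLt (β := β) (c := c) (L := L) T
  refine (Continuous.add ?_ ?_).add ?_ <;> split_ifs <;> fun_prop

lemma abs_mul_le_of_mem_unit {r C s : ℝ} (hr : |r| ≤ C) (hs : s ∈ Set.Icc (0 : ℝ) 1) :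
    |r * s| ≤ C := by
  rw [abs_mul, abs_of_nonneg hs.1]
  exact (mul_le_of_le_one_right (abs_nonneg _) hs.2).trans hr

lemma one_sub_mem_unit {s : ℝ} (hs : s ∈ Set.Icc (0 : ℝ) 1) : 1 - s ∈ Set.Icc (0 : ℝ) 1 :=
  ⟨sub_nonneg.2 hs.2, sub_le_self _ hs.1⟩

lemma abs_softEx₁_le [DecidableEq I] (a : I × J) (x) : |softEx₁ β c L a x| ≤ |β| :=
  abs_mul_le_of_mem_unit (abs_mul_le_of_mem_unit (abs_mul_le_of_mem_unit le_rfl (softEx_mem _ _))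
    (softAll_mem _ _)) (one_sub_mem_unit (softLt_mem _ _))

lemma abs_softEx₂_le [DecidableEq I] [DecidableEq J] (a b : I × J) (x) :
    |softEx₂ β c L a b x| ≤ β ^ 2 + β ^ 2 + β ^ 2 := by
  have hβ : |β ^ 2| ≤ β ^ 2 := by rw [abs_of_nonneg (sq_nonneg _)]
  refine (abs_add_le _ _).trans (add_le_add ((abs_add_le _ _).trans (add_le_add ?_ ?_)) ?_)
  · split_ifs
    · exact abs_mul_le_of_mem_unit (abs_mul_le_of_mem_unit (abs_mul_le_of_mem_unit
        (abs_mul_le_of_mem_unit (abs_mul_le_of_mem_unit hβ (softEx_mem _ _)) (softAll_mem _ _))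
        (one_sub_mem_unit (softLt_mem _ _))) (softAll_mem _ _)) (one_sub_mem_unit (softLt_mem _ _))
    · simpa using sq_nonneg β
  · split_ifs
    · rw [abs_neg]
      exact abs_mul_le_of_mem_unit (abs_mul_le_of_mem_unit
        (abs_mul_le_of_mem_unit (abs_mul_le_of_mem_unit hβ (softEx_mem _ _)) (softAll_mem _ _))
        (one_sub_mem_unit (softLt_mem _ _))) (one_sub_mem_unit (softLt_mem _ _))
    · simpa using sq_nonneg β
  · split_ifs
    · exact abs_mul_le_of_mem_unit (abs_mul_le_of_mem_unit
        (abs_mul_le_of_mem_unit (abs_mul_le_of_mem_unit hβ (softEx_mem _ _)) (softAll_mem _ _))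
        (softLt_mem _ _)) (one_sub_mem_unit (softLt_mem _ _))
    · simpa using sq_nonneg β

/-- Distinct rows enter through distinct factors 1 − `softAll`, whose first partials have the same
sign. Within a row the sign can fail, which is why Gordon's hypothesis demands equal covariances
there. -/
lemma softEx₂_nonneg [DecidableEq I] [DecidableEq J] {a b : I × J} (hab : a.1 ≠ b.1) (x) :
    0 ≤ softEx₂ β c L a b x := by
  have h1 : ¬ b.1 = a.1 := fun h => hab h.symm
  have h2 : ¬ b = a := fun h => h1 (by rw [h])
  rw [softEx₂, if_neg h1, if_neg h2, add_zero, add_zero]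
  split_ifs
  · exact mul_nonneg (mul_nonneg (mul_nonneg (mul_nonneg (mul_nonneg (sq_nonneg _)
      (softEx_mem _ _).1) (softAll_mem _ _).1) (one_sub_mem_unit (softLt_mem _ _)).1)
      (softAll_mem _ _).1) (one_sub_mem_unit (softLt_mem _ _)).1
  · exact le_rfl

open Classical in
lemma tendsto_softEx (x : I × J → ℝ) :
    Tendsto (fun N : ℕ => softEx ((N : ℝ) ^ 2) N L Finset.univ x) atTop
      (𝓝 (Set.indicator {x | ∀ i, ∃ j, L (i, j) ≤ x (i, j)} (fun _ => (1 : ℝ)) x)) := by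
  have h : Tendsto (fun N : ℕ => softEx ((N : ℝ) ^ 2) N L Finset.univ x) atTop
      (𝓝 (∏ i : I, (1 - ∏ j : J, if x (i, j) < L (i, j) then (1 : ℝ) else 0))) :=
    tendsto_finsetProd _ fun i _ => tendsto_const_nhds.sub
      (tendsto_finsetProd _ fun j _ => tendsto_softLt (i, j) x)
  convert h using 2
  have e : ∀ i : I, (1 - ∏ j : J, if x (i, j) < L (i, j) then (1 : ℝ) else 0)
      = if ∃ j, L (i, j) ≤ x (i, j) then 1 else 0 := by
    intro i
    rw [Finset.prod_ite_zero]
    split_ifs with h1 h2 h2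
    · obtain ⟨j, hj⟩ := h2
      exact absurd (h1 j (Finset.mem_univ j)) (not_lt.2 hj)
    · simp
    · simp
    · push Not at h2
      exact absurd (fun j _ => h2 j) h1
  simp_rw [e]
  rw [Finset.prod_ite_zero]
  simp [Set.indicator_apply]

end SmoothMinMax

/-! ### Gordon's inequality, finite and countable. -/

section Gordon

variable {κ : Type*} [Fintype κ]

/-- Gordon's comparison inequality for finite families. -/
theorem gordon_finite {I J : Type*} [Fintype I] [Fintype J]
    {X Y : I × J → κ → ℝ} (L : I × J → ℝ) (horth : ∀ a b, Y a ⬝ᵥ X b = 0)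
    (hcov : ∀ a b, X a ⬝ᵥ X b ≤ Y a ⬝ᵥ Y b)
    (hrow : ∀ a b, a.1 = b.1 → X a ⬝ᵥ X b = Y a ⬝ᵥ Y b) :
    stdGaussianPi κ {z | ∀ i, ∃ j, L (i, j) ≤ X (i, j) ⬝ᵥ z}
      ≤ stdGaussianPi κ {z | ∀ i, ∃ j, L (i, j) ≤ Y (i, j) ⬝ᵥ z} := by
  classical
  have hcont : ∀ X : I × J → κ → ℝ, Continuous (fun (z : κ → ℝ) a => X a ⬝ᵥ z) := fun X =>
    continuous_pi fun a => by unfold dotProduct; fun_prop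
  have hmeas : MeasurableSet {x : I × J → ℝ | ∀ i, ∃ j, L (i, j) ≤ x (i, j)} := by
    simp only [Set.ofPred_forall, Set.ofPred_exists]
    exact MeasurableSet.iInter fun i => MeasurableSet.iUnion fun j =>
      measurableSet_le measurable_const (measurable_pi_apply _)
  have hlim : ∀ X : I × J → κ → ℝ, Tendsto
      (fun N : ℕ => ∫ z, softEx ((N : ℝ) ^ 2) N L Finset.univ (fun a => X a ⬝ᵥ z)
        ∂stdGaussianPi κ) atTop
      (𝓝 ((stdGaussianPi κ).real {z | ∀ i, ∃ j, L (i, j) ≤ X (i, j) ⬝ᵥ z})) := by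
    intro X
    change Tendsto _ _ (𝓝 ((stdGaussianPi κ).real
      ((fun (z : κ → ℝ) a => X a ⬝ᵥ z) ⁻¹' {x | ∀ i, ∃ j, L (i, j) ≤ x (i, j)})))
    rw [← integral_indicator_one (hmeas.preimage (hcont X).measurable)]
    refine tendsto_integral_of_dominated_convergence (fun _ => 1)
      (fun N => ((continuous_softEx _).comp (hcont X)).aestronglyMeasurable)
      (integrable_const _) (fun N => .of_forall fun z => ?_) (.of_forall fun z => ?_)
    · rw [Real.norm_of_nonneg (softEx_mem _ _).1]
      exact (softEx_mem _ _).2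
    · exact tendsto_softEx (L := L) (fun a => X a ⬝ᵥ z)
  have hle := le_of_tendsto_of_tendsto' (hlim X) (hlim Y) fun N => by
    refine integral_gaussian_le_of_partials
      (C := 1 + |((N : ℝ) ^ 2)| + (((N : ℝ) ^ 2) ^ 2 + ((N : ℝ) ^ 2) ^ 2 + ((N : ℝ) ^ 2) ^ 2))
      hasPartials_softEx hasPartials_softEx₁
      (continuous_softEx _) continuous_softEx₁ continuous_softEx₂ (fun x => ?_) (fun a x => ?_)
      (fun a b x => ?_) horth hcov fun a b => ?_
    · rw [abs_of_nonneg (softEx_mem _ _).1]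
      refine (softEx_mem _ _).2.trans ?_
      rw [add_assoc]
      exact le_add_of_nonneg_right (by positivity)
    · refine (abs_softEx₁_le a x).trans ?_
      have : 0 ≤ (((N : ℝ) ^ 2) ^ 2 + ((N : ℝ) ^ 2) ^ 2 + ((N : ℝ) ^ 2) ^ 2) := by positivity
      linarith
    · refine (abs_softEx₂_le a b x).trans (le_add_of_nonneg_left (by positivity))
    · by_cases h : a.1 = b.1
      · exact .inl (hrow a b h)
      · exact .inr (softEx₂_nonneg h)
  exact (ENNReal.toReal_le_toReal (measure_ne_top _ _) (measure_ne_top _ _)).1 hle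

/-- Gordon's comparison inequality for countable families. -/
theorem gordon_countable {X Y : ℕ → ℕ → κ → ℝ} (L : ℕ → ℕ → ℝ)
    (horth : ∀ i j i' j', Y i j ⬝ᵥ X i' j' = 0)
    (hcov : ∀ i j i' j', X i j ⬝ᵥ X i' j' ≤ Y i j ⬝ᵥ Y i' j')
    (hrow : ∀ i j j', X i j ⬝ᵥ X i j' = Y i j ⬝ᵥ Y i j') :
    stdGaussianPi κ {z | ∀ i, ∃ j, L i j ≤ X i j ⬝ᵥ z}
      ≤ stdGaussianPi κ {z | ∀ i, ∃ j, L i j ≤ Y i j ⬝ᵥ z} := by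
  have hms : ∀ (X : ℕ → ℕ → κ → ℝ) i j, MeasurableSet {z : κ → ℝ | L i j ≤ X i j ⬝ᵥ z} := by
    intro X i j
    refine measurableSet_le measurable_const ?_
    unfold dotProduct; fun_prop
  have hfin : ∀ N M : ℕ, stdGaussianPi κ {z | ∀ i < N, ∃ j < M, L i j ≤ X i j ⬝ᵥ z}
      ≤ stdGaussianPi κ {z | ∀ i < N, ∃ j < M, L i j ≤ Y i j ⬝ᵥ z} := by
    intro N M
    have := gordon_finite (κ := κ) (I := Fin N) (J := Fin M)
      (X := fun a => X a.1 a.2) (Y := fun a => Y a.1 a.2) (fun a => L a.1 a.2)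
      (fun a b => horth _ _ _ _) (fun a b => hcov _ _ _ _)
      (fun a b h => by rw [h]; exact hrow _ _ _)
    simpa [Fin.forall_iff, Fin.exists_iff] using this
  -- The order of limits matters: with finitely many rows one column bound M serves them all, so the
  -- events increase to their limit. Only afterwards do the rows grow, along decreasing events.
  have hM : ∀ (X : ℕ → ℕ → κ → ℝ) N,
      Tendsto (fun M => stdGaussianPi κ {z | ∀ i < N, ∃ j < M, L i j ≤ X i j ⬝ᵥ z}) atTop
        (𝓝 (stdGaussianPi κ {z | ∀ i < N, ∃ j, L i j ≤ X i j ⬝ᵥ z})) := by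
    intro X N
    have hmono : Monotone fun M : ℕ => {z : κ → ℝ | ∀ i < N, ∃ j < M, L i j ≤ X i j ⬝ᵥ z} := by
      intro M M' h z hz i hi
      obtain ⟨j, hj, hz⟩ := hz i hi
      exact ⟨j, hj.trans_le h, hz⟩
    convert tendsto_measure_iUnion_atTop hmono using 3
    congr 1
    ext z
    simp only [Set.mem_ofPred_eq, Set.mem_iUnion]
    constructor
    · intro h
      choose! j hj using h
      refine ⟨(Finset.range N).sup j + 1, fun i hi => ⟨j i, ?_, hj i hi⟩⟩
      exact Nat.lt_succ_of_le (Finset.le_sup (f := j) (Finset.mem_range.2 hi))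
    · rintro ⟨M, hM⟩ i hi
      obtain ⟨j, _, hj⟩ := hM i hi
      exact ⟨j, hj⟩
  have hN : ∀ (X : ℕ → ℕ → κ → ℝ),
      Tendsto (fun N => stdGaussianPi κ {z | ∀ i < N, ∃ j, L i j ≤ X i j ⬝ᵥ z}) atTop
        (𝓝 (stdGaussianPi κ {z | ∀ i, ∃ j, L i j ≤ X i j ⬝ᵥ z})) := by
    intro X
    have hanti : Antitone fun N : ℕ => {z : κ → ℝ | ∀ i < N, ∃ j, L i j ≤ X i j ⬝ᵥ z} :=
      fun N N' h z hz i hi => hz i (hi.trans_le h)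
    have hm : ∀ N : ℕ, MeasurableSet {z : κ → ℝ | ∀ i < N, ∃ j, L i j ≤ X i j ⬝ᵥ z} := by
      intro N
      simp only [Set.ofPred_forall, Set.ofPred_exists]
      exact MeasurableSet.iInter fun i => MeasurableSet.iInter fun _ =>
        MeasurableSet.iUnion fun j => hms X i j
    convert tendsto_measure_iInter_atTop (μ := stdGaussianPi κ)
      (fun N => (hm N).nullMeasurableSet) hanti ⟨0, measure_ne_top _ _⟩ using 3
    congr 1
    ext z
    simp only [Set.mem_ofPred_eq, Set.mem_iInter]
    exact ⟨fun h N i _ => h i, fun h i => h (i + 1) i (Nat.lt_succ_self i)⟩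
  exact le_of_tendsto_of_tendsto' (hN X) (hN Y) fun N =>
    le_of_tendsto_of_tendsto' (hM X N) (hM Y N) fun M => hfin N M

lemma measurableSet_exists_forall_dotProduct_lt (X : ℕ → ℕ → κ → ℝ) (L : ℕ → ℕ → ℝ) :
    MeasurableSet {z : κ → ℝ | ∃ i, ∀ j, X i j ⬝ᵥ z < L i j} := by
  simp only [Set.ofPred_forall, Set.ofPred_exists]
  refine MeasurableSet.iUnion fun i => MeasurableSet.iInter fun j =>
    measurableSet_lt ?_ measurable_const
  unfold dotProduct; fun_prop

/-- Gordon's comparison inequality for countable families, in terms of lower tails. -/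
theorem gordon_countable_lt {X Y : ℕ → ℕ → κ → ℝ} (L : ℕ → ℕ → ℝ)
    (horth : ∀ i j i' j', Y i j ⬝ᵥ X i' j' = 0)
    (hcov : ∀ i j i' j', X i j ⬝ᵥ X i' j' ≤ Y i j ⬝ᵥ Y i' j')
    (hrow : ∀ i j j', X i j ⬝ᵥ X i j' = Y i j ⬝ᵥ Y i j') :
    stdGaussianPi κ {z | ∃ i, ∀ j, Y i j ⬝ᵥ z < L i j}
      ≤ stdGaussianPi κ {z | ∃ i, ∀ j, X i j ⬝ᵥ z < L i j} := by
  have hcompl : ∀ X : ℕ → ℕ → κ → ℝ, stdGaussianPi κ {z | ∃ i, ∀ j, X i j ⬝ᵥ z < L i j}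
      = 1 - stdGaussianPi κ {z | ∀ i, ∃ j, L i j ≤ X i j ⬝ᵥ z} := by
    intro X
    have e : {z | ∀ i, ∃ j, L i j ≤ X i j ⬝ᵥ z} = {z | ∃ i, ∀ j, X i j ⬝ᵥ z < L i j}ᶜ := by
      ext z
      simp
    rw [e, ← prob_compl_eq_one_sub (measurableSet_exists_forall_dotProduct_lt X L).compl,
      compl_compl]
  rw [hcompl X, hcompl Y]
  exact tsub_le_tsub_left (gordon_countable L horth hcov hrow) 1

end Gordon

/-! ### Attainment, countable reduction and weak duality. -/

section MinMax

variable {X Y : Type*} [TopologicalSpace X] [TopologicalSpace Y] {A : Set X} {B : Set Y}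
  {F : X → Y → ℝ}

lemma continuous_subtype_uncurry (hF : ContinuousOn (Function.uncurry F) (A ×ˢ B)) :
    Continuous fun q : A × B => F q.1 q.2 :=
  hF.comp_continuous (f := fun q : A × B => ((q.1 : X), (q.2 : Y))) (by fun_prop)
    fun q => ⟨q.1.2, q.2.2⟩

lemma continuous_iSup_subtype (hB : IsCompact B)
    (hF : ContinuousOn (Function.uncurry F) (A ×ˢ B)) :
    Continuous fun w : A => ⨆ u : B, F w u := by
  have : CompactSpace B := isCompact_iff_compactSpace.1 hB
  have h := IsCompact.continuous_sSup (f := fun (w : A) (u : B) => F w u) isCompact_univ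
    (continuous_subtype_uncurry hF)
  simpa only [Set.image_univ, sSup_range] using h

lemma bddAbove_range_right (hB : IsCompact B)
    (hF : ContinuousOn (Function.uncurry F) (A ×ˢ B)) {w : X} (hw : w ∈ A) :
    BddAbove (Set.range fun u : B => F w u) := by
  have : CompactSpace B := isCompact_iff_compactSpace.1 hB
  exact isCompact_range ((continuous_subtype_uncurry hF).comp
    (Continuous.prodMk_right (⟨w, hw⟩ : A))) |>.bddAbove

lemma bddBelow_range_iSup (hA : IsCompact A) (hB : IsCompact B)
    (hF : ContinuousOn (Function.uncurry F) (A ×ˢ B)) :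
    BddBelow (Set.range fun w : A => ⨆ u : B, F w u) := by
  have : CompactSpace A := isCompact_iff_compactSpace.1 hA
  exact (isCompact_range (continuous_iSup_subtype hB hF)).bddBelow

lemma minMax_le_iSup (hA : IsCompact A) (hB : IsCompact B)
    (hF : ContinuousOn (Function.uncurry F) (A ×ˢ B)) {w : X} (hw : w ∈ A) :
    minMax A B F ≤ ⨆ u : B, F w u :=
  ciInf_le (bddBelow_range_iSup hA hB hF) (⟨w, hw⟩ : A)

lemma optSol_nonempty (hAne : A.Nonempty) (hA : IsCompact A) (hB : IsCompact B)
    (hF : ContinuousOn (Function.uncurry F) (A ×ˢ B)) : (optSol A B F).Nonempty := by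
  have hc : ContinuousOn (fun w => ⨆ u : B, F w u) A :=
    continuousOn_iff_continuous_domRestrict.2 (continuous_iSup_subtype hB hF)
  obtain ⟨w, hw, h⟩ := hA.exists_isMinOn hAne hc
  exact ⟨w, hw, h⟩

lemma iSup_eq_minMax_of_mem_optSol (hA : IsCompact A) (hB : IsCompact B)
    (hF : ContinuousOn (Function.uncurry F) (A ×ˢ B)) {w : X} (hw : w ∈ optSol A B F) :
    ⨆ u : B, F w u = minMax A B F := by
  have : Nonempty A := ⟨⟨w, hw.1⟩⟩
  exact le_antisymm (le_ciInf fun w' => hw.2 w'.2) (minMax_le_iSup hA hB hF hw.1)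

/-- The strict sublevel set of w ↦ sup F w is open, hence meets the dense sequence. -/
lemma exists_dense_lt_of_minMax_lt (hAne : A.Nonempty) (hB : IsCompact B)
    (hF : ContinuousOn (Function.uncurry F) (A ×ˢ B)) {c : ℝ} (h : minMax A B F < c)
    {s : ℕ → A} (hs : DenseRange s) : ∃ i, ∀ u : B, F (s i) u < c := by
  have : Nonempty A := hAne.to_subtype
  obtain ⟨w, hw⟩ := exists_lt_of_ciInf_lt h
  obtain ⟨i, hi⟩ := hs.exists_mem_open
    (isOpen_Iio.preimage (continuous_iSup_subtype hB hF)) ⟨w, hw⟩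
  exact ⟨i, fun u => (le_ciSup (bddAbove_range_right hB hF (s i).2) u).trans_lt hi⟩

/-- A bound on a dense sequence passes to the closure only as ≤, hence < on one side and ≤ on the
other side of the tail bounds. -/
lemma minMax_le_of_dense_le (hBne : B.Nonempty) (hA : IsCompact A) (hB : IsCompact B)
    (hF : ContinuousOn (Function.uncurry F) (A ×ˢ B)) {c : ℝ} {w : A} {r : ℕ → B}
    (hr : DenseRange r) (h : ∀ j, F w (r j) ≤ c) : minMax A B F ≤ c := by
  have : Nonempty B := hBne.to_subtype
  refine (minMax_le_iSup hA hB hF w.2).trans (ciSup_le fun u => ?_)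
  have hcl : IsClosed {u : B | F w u ≤ c} :=
    isClosed_le ((continuous_subtype_uncurry hF).comp (Continuous.prodMk_right w))
      continuous_const
  exact hr.induction_on (p := fun u => F w u ≤ c) u hcl h

/-- Weak duality. -/
lemma neg_minMax_le_minMax_swap_neg (hAne : A.Nonempty) (hBne : B.Nonempty)
    (hA : IsCompact A) (hB : IsCompact B)
    (hF : ContinuousOn (Function.uncurry F) (A ×ˢ B)) :
    -minMax A B F ≤ minMax B A fun u w => -F w u := by
  have : Nonempty A := hAne.to_subtype
  have : Nonempty B := hBne.to_subtype
  have hF' : ContinuousOn (Function.uncurry fun u w => -F w u) (B ×ˢ A) :=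
    (hF.comp continuous_swap.continuousOn fun q hq => ⟨hq.2, hq.1⟩).neg
  refine le_ciInf fun u => ?_
  rw [neg_le]
  refine le_ciInf fun w => ?_
  rw [neg_le]
  exact (neg_le_neg (le_ciSup (bddAbove_range_right hB hF w.2) u)).trans
    (le_ciSup (bddAbove_range_right hA hF' u.2) w)

end MinMax

/-! ### Strong duality through a saddle point. -/

section Minimax

variable {E E' : Type*} [TopologicalSpace E] [AddCommGroup E] [Module ℝ E]
  [IsTopologicalAddGroup E] [ContinuousSMul ℝ E] [TopologicalSpace E'] [AddCommGroup E']
  [Module ℝ E'] [IsTopologicalAddGroup E'] [ContinuousSMul ℝ E']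
  {A : Set E} {B : Set E'} {F : E → E' → ℝ}

/-- Strong duality for convex-concave continuous functions. -/
lemma minMax_swap_neg_le_neg_minMax (hAne : A.Nonempty) (hBne : B.Nonempty)
    (hA : IsCompact A) (hB : IsCompact B) (hAc : Convex ℝ A) (hBc : Convex ℝ B)
    (hF : ContinuousOn (Function.uncurry F) (A ×ˢ B))
    (hcvx : ∀ u ∈ B, ConvexOn ℝ A fun w => F w u)
    (hccv : ∀ w ∈ A, ConcaveOn ℝ B fun u => F w u) :
    minMax B A (fun u w => -F w u) ≤ -minMax A B F := by
  have : Nonempty A := hAne.to_subtype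
  have : Nonempty B := hBne.to_subtype
  have hF' : ContinuousOn (Function.uncurry fun u w => -F w u) (B ×ˢ A) :=
    (hF.comp continuous_swap.continuousOn fun q hq => ⟨hq.2, hq.1⟩).neg
  obtain ⟨a, ha, b, hb, hab⟩ := Sion.exists_isSaddlePointOn (f := F) hAne hAc hA
    (fun u hu => ContinuousOn.lowerSemicontinuousOn
      (hF.comp (by fun_prop : Continuous fun w : E => (w, u)).continuousOn
        fun w hw => ⟨hw, hu⟩))
    (fun u hu => (hcvx u hu).quasiconvexOn) hBc hBne hB
    (fun w hw => ContinuousOn.upperSemicontinuousOn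
      (hF.comp (by fun_prop : Continuous fun u : E' => (w, u)).continuousOn
        fun u hu => ⟨hw, hu⟩))
    (fun w hw => (hccv w hw).quasiconcaveOn)
  have h1 : minMax A B F ≤ F a b :=
    (minMax_le_iSup hA hB hF ha).trans (ciSup_le fun u => hab a ha u u.2)
  have h2 : minMax B A (fun u w => -F w u) ≤ -F a b :=
    (minMax_le_iSup hB hA hF' hb).trans (ciSup_le fun w => neg_le_neg (hab w w.2 b hb))
  linarith

end Minimax

/-! ### Independent sign constraints. -/

section GaussianSum

variable {κ κ' : Type*} [Fintype κ] [Fintype κ']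

lemma measurePreserving_sum_stdGaussianPi :
    MeasurePreserving (fun z : κ ⊕ κ' → ℝ => (fun a => z (.inl a), fun a => z (.inr a)))
      (stdGaussianPi (κ ⊕ κ')) ((stdGaussianPi κ).prod (stdGaussianPi κ')) :=
  measurePreserving_sumPiEquivProdPi (fun _ : κ ⊕ κ' => gaussianReal 0 1)

lemma measurePreserving_inl_stdGaussianPi :
    MeasurePreserving (fun (z : κ ⊕ κ' → ℝ) a => z (.inl a))
      (stdGaussianPi (κ ⊕ κ')) (stdGaussianPi κ) :=
  measurePreserving_fst.comp measurePreserving_sum_stdGaussianPi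

lemma one_le_two_mul_gaussianReal_Iic : 1 ≤ 2 * gaussianReal 0 1 (Set.Iic 0) := by
  have h : gaussianReal 0 1 (Set.Ici 0) = gaussianReal 0 1 (Set.Iic 0) := by
    conv_lhs => rw [← neg_zero (G := ℝ), ← gaussianReal_map_neg (μ := 0) (v := 1)]
    rw [Measure.map_apply measurable_neg measurableSet_Ici]
    congr 1
    ext x
    simp
  calc (1 : ENNReal) = gaussianReal 0 1 (Set.Iic 0 ∪ Set.Ici 0) := by
        rw [Set.Iic_union_Ici, measure_univ]
    _ ≤ _ := measure_union_le _ _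
    _ = _ := by rw [h, two_mul]

/-- Adding independent sign constraints costs at most a factor two for each of them. -/
lemma stdGaussianPi_le_two_pow_mul {T : Set (κ → ℝ)} :
    stdGaussianPi κ T ≤ 2 ^ Fintype.card κ' *
      stdGaussianPi (κ ⊕ κ') {z | (fun a => z (.inl a)) ∈ T ∧ ∀ i, z (.inr i) ≤ 0} := by
  have h : {z : κ ⊕ κ' → ℝ | (fun a => z (.inl a)) ∈ T ∧ ∀ i, z (.inr i) ≤ 0}
      = (MeasurableEquiv.sumPiEquivProdPi fun _ : κ ⊕ κ' => ℝ) ⁻¹'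
        (T ×ˢ Set.univ.pi fun _ => Set.Iic 0) := by
    ext z
    simp [MeasurableEquiv.coe_sumPiEquivProdPi, Equiv.sumPiEquivProdPi, Pi.le_def]
  -- Working with a measurable equivalence lets T be an arbitrary set.
  have hp : stdGaussianPi (κ ⊕ κ') ((MeasurableEquiv.sumPiEquivProdPi fun _ : κ ⊕ κ' => ℝ) ⁻¹'
        (T ×ˢ Set.univ.pi fun _ => Set.Iic 0))
      = (stdGaussianPi κ).prod (stdGaussianPi κ') (T ×ˢ Set.univ.pi fun _ => Set.Iic 0) :=
    (measurePreserving_sumPiEquivProdPi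
      (fun _ : κ ⊕ κ' => gaussianReal 0 1)).measure_preimage_equiv _
  rw [h, hp, Measure.prod_prod]
  have e : stdGaussianPi κ' (Set.univ.pi fun _ => Set.Iic (0 : ℝ))
      = gaussianReal 0 1 (Set.Iic 0) ^ Fintype.card κ' := by
    rw [stdGaussianPi, Measure.pi_pi, Finset.prod_const, Finset.card_univ]
  rw [e, mul_left_comm, ← mul_pow]
  exact le_mul_of_one_le_right' (one_le_pow_of_one_le' one_le_two_mul_gaussianReal_Iic _)

end GaussianSum

/-! ### Covariances of the two processes. -/

section Comparison

variable {ℓ : ℕ} {n k : Fin ℓ → ℕ}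

/-- The index set of all the scalar entries of `G`, `g` and `h`. -/
abbrev EntryIndex (n k : Fin ℓ → ℕ) : Type :=
  (Σ i, Fin (n i) × Fin (k i)) ⊕ (Σ i, Fin (k i)) ⊕ (Σ i, Fin (n i))

/-- The coefficients of `∑ i, uᵢᵀ Gᵢ wᵢ`. -/
def poVec (w : BlockVec k) (u : BlockVec n) : EntryIndex n k → ℝ
  | .inl ⟨i, a, b⟩ => u i a * w i b
  | .inr _ => 0

/-- The coefficients of `∑ i, ‖uᵢ‖ gᵢᵀ wᵢ + ∑ i, ‖wᵢ‖ hᵢᵀ uᵢ`. -/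
noncomputable def aoVec (w : BlockVec k) (u : BlockVec n) : EntryIndex n k → ℝ
  | .inl _ => 0
  | .inr (.inl ⟨i, b⟩) => ‖u i‖ * w i b
  | .inr (.inr ⟨i, a⟩) => ‖w i‖ * u i a

/-- The coefficients of the primary process with one extra Gaussian variable for each block. -/
noncomputable def poVecExt (w : BlockVec k) (u : BlockVec n) : EntryIndex n k ⊕ Fin ℓ → ℝ :=
  Sum.elim (poVec w u) fun i => ‖w i‖ * ‖u i‖

/-- The coefficients of the auxiliary process, ignoring the extra variables. -/
noncomputable def aoVecExt (w : BlockVec k) (u : BlockVec n) : EntryIndex n k ⊕ Fin ℓ → ℝ :=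
  Sum.elim (aoVec w u) fun _ => 0

/-- The supports are disjoint: G and the extra variables against g and h. -/
lemma poVecExt_dotProduct_aoVecExt (w w' : BlockVec k) (u u' : BlockVec n) :
    poVecExt w u ⬝ᵥ aoVecExt w' u' = 0 := by
  simp [dotProduct, poVecExt, aoVecExt, poVec, aoVec, Fintype.sum_sum_type]

lemma poVecExt_dotProduct_poVecExt (w w' : BlockVec k) (u u' : BlockVec n) :
    poVecExt w u ⬝ᵥ poVecExt w' u' = ∑ i, (inner ℝ (u i) (u' i) * inner ℝ (w i) (w' i)
      + ‖w i‖ * ‖u i‖ * (‖w' i‖ * ‖u' i‖)) := by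
  simp only [dotProduct, poVecExt, poVec, Fintype.sum_sum_type, Sum.elim_inl, Sum.elim_inr,
    Fintype.sum_sigma, Fintype.sum_prod_type, mul_zero, Finset.sum_const_zero, add_zero,
    Finset.sum_add_distrib]
  congr 1
  refine Finset.sum_congr rfl fun i _ => ?_
  simp only [PiLp.inner_apply, RCLike.inner_apply, conj_trivial, Finset.sum_mul_sum]
  exact Finset.sum_congr rfl fun a _ => Finset.sum_congr rfl fun b _ => by ring

lemma aoVecExt_dotProduct_aoVecExt (w w' : BlockVec k) (u u' : BlockVec n) :
    aoVecExt w u ⬝ᵥ aoVecExt w' u' = ∑ i, (‖u i‖ * ‖u' i‖ * inner ℝ (w i) (w' i)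
      + ‖w i‖ * ‖w' i‖ * inner ℝ (u i) (u' i)) := by
  simp only [dotProduct, aoVecExt, aoVec, Fintype.sum_sum_type, Sum.elim_inl, Sum.elim_inr,
    Fintype.sum_sigma, mul_zero, Finset.sum_const_zero, zero_add, add_zero,
    Finset.sum_add_distrib]
  congr 1 <;>
  · refine Finset.sum_congr rfl fun i _ => ?_
    simp only [PiLp.inner_apply, RCLike.inner_apply, conj_trivial, Finset.mul_sum]
    exact Finset.sum_congr rfl fun a _ => by ring

/-- Blockwise the difference is a product of two Cauchy–Schwarz defects. -/
lemma aoVecExt_cov_le (w w' : BlockVec k) (u u' : BlockVec n) :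
    aoVecExt w u ⬝ᵥ aoVecExt w' u' ≤ poVecExt w u ⬝ᵥ poVecExt w' u' := by
  rw [aoVecExt_dotProduct_aoVecExt, poVecExt_dotProduct_poVecExt]
  refine Finset.sum_le_sum fun i _ => ?_
  nlinarith [mul_nonneg (sub_nonneg.2 (real_inner_le_norm (u i) (u' i)))
    (sub_nonneg.2 (real_inner_le_norm (w i) (w' i)))]

/-- The defect in w vanishes when both arguments are the same w. -/
lemma aoVecExt_cov_eq (w : BlockVec k) (u u' : BlockVec n) :
    aoVecExt w u ⬝ᵥ aoVecExt w u' = poVecExt w u ⬝ᵥ poVecExt w u' := by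
  rw [aoVecExt_dotProduct_aoVecExt, poVecExt_dotProduct_poVecExt]
  refine Finset.sum_congr rfl fun i _ => ?_
  rw [real_inner_self_eq_norm_mul_norm]
  ring

variable {Ω : Type*} {G : Ω → BlockMat n k} {g : Ω → BlockVec k} {h : Ω → BlockVec n}

lemma poCost_eq_dotProduct (ψ : BlockVec k → BlockVec n → ℝ) (ω : Ω) (w : BlockVec k)
    (u : BlockVec n) :
    poCost ψ (G ω) w u = poVec w u ⬝ᵥ (fun j => entries G g h j ω) + ψ w u := by
  simp only [poCost, dotProduct, poVec, entries, Fintype.sum_sum_type, Fintype.sum_sigma,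
    Fintype.sum_prod_type, zero_mul, Finset.sum_const_zero, add_zero, Matrix.mulVec,
    Finset.mul_sum]
  congr 1
  refine Finset.sum_congr rfl fun i _ => Finset.sum_congr rfl fun a _ =>
    Finset.sum_congr rfl fun b _ => by ring

lemma aoCost_eq_dotProduct (ψ : BlockVec k → BlockVec n → ℝ) (ω : Ω) (w : BlockVec k)
    (u : BlockVec n) :
    aoCost ψ (g ω) (h ω) w u = aoVec w u ⬝ᵥ (fun j => entries G g h j ω) + ψ w u := by
  simp only [aoCost, dotProduct, aoVec, entries, Fintype.sum_sum_type, Fintype.sum_sigma,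
    zero_mul, Finset.sum_const_zero, zero_add, PiLp.inner_apply, RCLike.inner_apply,
    conj_trivial, Finset.mul_sum]
  congr 2 <;>
  · refine Finset.sum_congr rfl fun i _ => Finset.sum_congr rfl fun a _ => by ring

lemma continuousOn_poCost {ψ : BlockVec k → BlockVec n → ℝ} {A : Set (BlockVec k)}
    {B : Set (BlockVec n)} (hψ : ContinuousOn (Function.uncurry ψ) (A ×ˢ B)) (G : BlockMat n k) :
    ContinuousOn (Function.uncurry (poCost ψ G)) (A ×ˢ B) := by
  refine ContinuousOn.add (Continuous.continuousOn ?_) hψ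
  simp only [dotProduct, Matrix.mulVec]
  fun_prop

lemma continuousOn_aoCost {ψ : BlockVec k → BlockVec n → ℝ} {A : Set (BlockVec k)}
    {B : Set (BlockVec n)} (hψ : ContinuousOn (Function.uncurry ψ) (A ×ˢ B))
    (g : BlockVec k) (h : BlockVec n) :
    ContinuousOn (Function.uncurry (aoCost ψ g h)) (A ×ˢ B) := by
  refine ContinuousOn.add (Continuous.continuousOn ?_) hψ
  fun_prop

end Comparison

/-! ### Tail bounds for the primary cost. -/

section GaussianMinMax

variable {ℓ : ℕ} {n k : Fin ℓ → ℕ} {Ω : Type*} [MeasurableSpace Ω] {P : Measure Ω}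
  {G : Ω → BlockMat n k} {g : Ω → BlockVec k} {h : Ω → BlockVec n}

/-- Comparison of lower tails on the canonical space: the extra Gaussian variables are removed
by conditioning on their signs. -/
lemma stdGaussianPi_po_lt_le (w : ℕ → BlockVec k) (u : ℕ → BlockVec n) (L : ℕ → ℕ → ℝ) :
    stdGaussianPi (EntryIndex n k) {z | ∃ i, ∀ j, poVec (w i) (u j) ⬝ᵥ z < L i j}
      ≤ 2 ^ ℓ * stdGaussianPi (EntryIndex n k)
        {z | ∃ i, ∀ j, aoVec (w i) (u j) ⬝ᵥ z < L i j} := by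
  have hgordon := gordon_countable_lt (κ := EntryIndex n k ⊕ Fin ℓ)
    (X := fun i j => aoVecExt (w i) (u j)) (Y := fun i j => poVecExt (w i) (u j)) L
    (fun i j i' j' => poVecExt_dotProduct_aoVecExt _ _ _ _)
    (fun i j i' j' => aoVecExt_cov_le _ _ _ _) (fun i j j' => aoVecExt_cov_eq _ _ _)
  calc stdGaussianPi (EntryIndex n k) {z | ∃ i, ∀ j, poVec (w i) (u j) ⬝ᵥ z < L i j}
      ≤ 2 ^ Fintype.card (Fin ℓ) * stdGaussianPi (EntryIndex n k ⊕ Fin ℓ)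
          {z | (fun a => z (.inl a)) ∈ {z | ∃ i, ∀ j, poVec (w i) (u j) ⬝ᵥ z < L i j}
            ∧ ∀ i, z (.inr i) ≤ 0} := stdGaussianPi_le_two_pow_mul
    _ ≤ 2 ^ ℓ * stdGaussianPi (EntryIndex n k ⊕ Fin ℓ)
          {z | ∃ i, ∀ j, poVecExt (w i) (u j) ⬝ᵥ z < L i j} := by
        rw [Fintype.card_fin]
        refine mul_le_mul_right (measure_mono ?_) _
        rintro z ⟨⟨i, hi⟩, hz⟩
        refine ⟨i, fun j => lt_of_le_of_lt ?_ (hi j)⟩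
        simp only [dotProduct, poVecExt, Fintype.sum_sum_type, Sum.elim_inl, Sum.elim_inr]
        exact add_le_of_nonpos_right (Finset.sum_nonpos fun i _ =>
          mul_nonpos_of_nonneg_of_nonpos (by positivity) (hz i))
    _ ≤ 2 ^ ℓ * stdGaussianPi (EntryIndex n k ⊕ Fin ℓ)
          {z | ∃ i, ∀ j, aoVecExt (w i) (u j) ⬝ᵥ z < L i j} := mul_le_mul_right hgordon _
    _ = 2 ^ ℓ * stdGaussianPi (EntryIndex n k)
        {z | ∃ i, ∀ j, aoVec (w i) (u j) ⬝ᵥ z < L i j} := by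
        rw [← (measurePreserving_inl_stdGaussianPi (κ' := Fin ℓ)).measure_preimage
          (measurableSet_exists_forall_dotProduct_lt (fun i j => aoVec (w i) (u j)) L).nullMeasurableSet]
        congr 2
        ext z
        simp [dotProduct, aoVecExt, Fintype.sum_sum_type]

/-- Lower tails of the primary optimal cost are controlled by those of the auxiliary one. -/
theorem measure_minMax_poCost_lt_le (hG : IsStdGaussian P G g h)
    {ψ : BlockVec k → BlockVec n → ℝ} {A : Set (BlockVec k)} {B : Set (BlockVec n)}
    (hAne : A.Nonempty) (hBne : B.Nonempty) (hA : IsCompact A) (hB : IsCompact B)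
    (hψ : ContinuousOn (Function.uncurry ψ) (A ×ˢ B)) (c : ℝ) :
    P {ω | minMax A B (poCost ψ (G ω)) < c}
      ≤ 2 ^ ℓ * P {ω | minMax A B (aoCost ψ (g ω) (h ω)) ≤ c} := by
  have : Nonempty A := hAne.to_subtype
  have : Nonempty B := hBne.to_subtype
  let s : ℕ → A := TopologicalSpace.denseSeq A
  let r : ℕ → B := TopologicalSpace.denseSeq B
  have hs : DenseRange s := TopologicalSpace.denseRange_denseSeq A
  have hr : DenseRange r := TopologicalSpace.denseRange_denseSeq B
  have hlaw : HasLaw (fun ω j => entries G g h j ω) (stdGaussianPi (EntryIndex n k)) P :=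
    hG.2.hasLaw_pi hG.1
  -- Dense sequences replace the min-max events by countable, measurable events in the entries, so
  -- the joint law transfers the comparison without measurability of the optimal costs.
  calc P {ω | minMax A B (poCost ψ (G ω)) < c}
      ≤ P ((fun ω j => entries G g h j ω) ⁻¹'
          {z | ∃ i, ∀ j, poVec (s i) (r j) ⬝ᵥ z < c - ψ (s i) (r j)}) := by
        refine measure_mono fun ω hω => ?_
        obtain ⟨i, hi⟩ := exists_dense_lt_of_minMax_lt hAne hB (continuousOn_poCost hψ _) hω hs
        refine ⟨i, fun j => ?_⟩
        have := hi (r j)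
        rw [poCost_eq_dotProduct (g := g) (h := h)] at this
        exact lt_sub_iff_add_lt.2 this
    _ = stdGaussianPi (EntryIndex n k)
          {z | ∃ i, ∀ j, poVec (s i) (r j) ⬝ᵥ z < c - ψ (s i) (r j)} := by
        rw [← Measure.map_apply_of_aemeasurable hlaw.aemeasurable
          (measurableSet_exists_forall_dotProduct_lt _ _), hlaw.map_eq]
    _ ≤ _ := stdGaussianPi_po_lt_le _ _ _
    _ = 2 ^ ℓ * P ((fun ω j => entries G g h j ω) ⁻¹'
          {z | ∃ i, ∀ j, aoVec (s i) (r j) ⬝ᵥ z < c - ψ (s i) (r j)}) := by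
        rw [← Measure.map_apply_of_aemeasurable hlaw.aemeasurable
          (measurableSet_exists_forall_dotProduct_lt _ _), hlaw.map_eq]
    _ ≤ 2 ^ ℓ * P {ω | minMax A B (aoCost ψ (g ω) (h ω)) ≤ c} := by
        gcongr
        rintro ω ⟨i, hi⟩
        refine minMax_le_of_dense_le hBne hA hB (continuousOn_aoCost hψ _ _) hr (w := s i)
          fun j => ?_
        rw [aoCost_eq_dotProduct (G := G)]
        exact (lt_sub_iff_add_lt.1 (hi j)).le

/-- Exchanging the roles of the two players. -/
lemma IsStdGaussian.swap_neg (hG : IsStdGaussian P G g h) :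
    IsStdGaussian P (fun ω i => -(G ω i)ᵀ) (fun ω => -h ω) (fun ω => -g ω) := by
  let σ : EntryIndex k n → EntryIndex n k
    | .inl ⟨i, a, b⟩ => .inl ⟨i, b, a⟩
    | .inr (.inl j) => .inr (.inr j)
    | .inr (.inr j) => .inr (.inl j)
  have hσ : Function.Injective σ := by
    rintro (⟨i, a, b⟩ | j | j) (⟨i', a', b'⟩ | j' | j') hj <;> simp_all [σ]
    obtain ⟨rfl, hj⟩ := hj
    simp_all
  have e : entries (fun ω i => -(G ω i)ᵀ) (fun ω => -h ω) (fun ω => -g ω)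
      = fun j ω => -entries G g h (σ j) ω := by
    funext j ω
    rcases j with ⟨i, a, b⟩ | ⟨i, a⟩ | ⟨i, a⟩ <;> simp [entries, σ]
  refine ⟨fun j => ?_, ?_⟩
  · rw [e]
    have := gaussianReal_neg (hG.1 (σ j))
    rwa [neg_zero] at this
  · rw [e]
    exact (hG.2.precomp hσ).comp (fun _ x => -x) fun _ => measurable_neg

/-- Upper tails of the primary optimal cost, in the convex-concave case. -/
theorem measure_lt_minMax_poCost_le (hG : IsStdGaussian P G g h)
    {ψ : BlockVec k → BlockVec n → ℝ} {A : Set (BlockVec k)} {B : Set (BlockVec n)}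
    (hAne : A.Nonempty) (hBne : B.Nonempty) (hA : IsCompact A) (hB : IsCompact B)
    (hAc : Convex ℝ A) (hBc : Convex ℝ B)
    (hψ : ContinuousOn (Function.uncurry ψ) (A ×ˢ B))
    (hcvx : ∀ u ∈ B, ConvexOn ℝ A fun w => ψ w u)
    (hccv : ∀ w ∈ A, ConcaveOn ℝ B fun u => ψ w u) (c : ℝ) :
    P {ω | c < minMax A B (poCost ψ (G ω))}
      ≤ 2 ^ ℓ * P {ω | c ≤ minMax A B (aoCost ψ (g ω) (h ω))} := by
  have hψ' : ContinuousOn (Function.uncurry fun u w => -ψ w u) (B ×ˢ A) :=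
    (hψ.comp continuous_swap.continuousOn fun q hq => ⟨hq.2, hq.1⟩).neg
  have epo : ∀ ω, poCost (fun u w => -ψ w u) (fun i => -(G ω i)ᵀ)
      = fun u w => -poCost ψ (G ω) w u := by
    intro ω
    funext u w
    simp only [poCost, neg_add, ← Finset.sum_neg_distrib, Matrix.neg_mulVec, dotProduct_neg]
    congr 1
    refine Finset.sum_congr rfl fun i _ => ?_
    rw [Matrix.mulVec_transpose, dotProduct_comm, Matrix.dotProduct_mulVec]
  have eao : ∀ ω, aoCost (fun u w => -ψ w u) (-h ω) (-g ω)
      = fun u w => -aoCost ψ (g ω) (h ω) w u := by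
    intro ω
    funext u w
    simp only [aoCost, Pi.neg_apply, inner_neg_left, mul_neg, Finset.sum_neg_distrib]
    ring
  have key := measure_minMax_poCost_lt_le hG.swap_neg hBne hAne hB hA hψ' (-c)
  simp only [epo, eao] at key
  refine le_trans (measure_mono fun ω hω => ?_) (key.trans ?_)
  · have hlin : ∀ (u : BlockVec n) (w w' : BlockVec k) (a b : ℝ),
        ∑ i, (u i).ofLp ⬝ᵥ (G ω i *ᵥ ((a • w + b • w') i).ofLp)
          = a * (∑ i, (u i).ofLp ⬝ᵥ (G ω i *ᵥ (w i).ofLp))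
            + b * ∑ i, (u i).ofLp ⬝ᵥ (G ω i *ᵥ (w' i).ofLp) := by
      intro u w w' a b
      simp [Matrix.mulVec_add, Matrix.mulVec_smul, Finset.sum_add_distrib, Finset.mul_sum]
    have hlin' : ∀ (w : BlockVec k) (u u' : BlockVec n) (a b : ℝ),
        ∑ i, ((a • u + b • u') i).ofLp ⬝ᵥ (G ω i *ᵥ (w i).ofLp)
          = a * (∑ i, (u i).ofLp ⬝ᵥ (G ω i *ᵥ (w i).ofLp))
            + b * ∑ i, (u' i).ofLp ⬝ᵥ (G ω i *ᵥ (w i).ofLp) := by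
      intro w u u' a b
      simp [Finset.sum_add_distrib, Finset.mul_sum]
    have := minMax_swap_neg_le_neg_minMax hAne hBne hA hB hAc hBc (continuousOn_poCost hψ (G ω))
      (fun u hu => ConvexOn.add ⟨hAc, fun w _ w' _ a b _ _ _ => (hlin u w w' a b).le⟩
        (hcvx u hu))
      (fun w hw => ConcaveOn.add ⟨hBc, fun u _ u' _ a b _ _ _ => (hlin' w u u' a b).ge⟩
        (hccv w hw))
    exact this.trans_lt (neg_lt_neg hω)
  · refine mul_le_mul_right (measure_mono fun ω hω => ?_) _
    -- Weak duality alone: the exchanged auxiliary cost is at least the negative of the original.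
    have := neg_minMax_le_minMax_swap_neg hAne hBne hA hB (continuousOn_aoCost hψ (g ω) (h ω))
    exact neg_le_neg_iff.1 (this.trans hω)

end GaussianMinMax

/-! ### Limits in probability. -/

/-- Subadditivity gives 1 ≤ P T + P Tᶜ without measurability, which is not established for the
events about optimal solutions. -/
lemma tendsto_measure_one_of_compl {Ω : Type*} [MeasurableSpace Ω] {P : Measure Ω}
    [IsProbabilityMeasure P] {T : ℕ → Set Ω} (h : Tendsto (fun m => P (T m)ᶜ) atTop (𝓝 0)) :
    Tendsto (fun m => P (T m)) atTop (𝓝 1) := by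
  refine tendsto_of_tendsto_of_tendsto_of_le_of_le (g := fun m => 1 - P (T m)ᶜ) ?_
    tendsto_const_nhds (fun m => ?_) fun m => prob_le_one
  · simpa using ENNReal.Tendsto.sub tendsto_const_nhds h (.inl ENNReal.one_ne_top)
  · rw [tsub_le_iff_right, ← measure_univ (μ := P), ← Set.union_compl_self (T m)]
    exact measure_union_le _ _

lemma tendsto_measure_zero_of_le_two_pow_mul {Ω : Type*} [MeasurableSpace Ω] {P : Measure Ω}
    {ℓ : ℕ} {T U V : ℕ → Set Ω} (hV : Tendsto (fun m => P (V m)) atTop (𝓝 0))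
    (hUV : ∀ m, U m ⊆ V m) (hTU : ∀ m, P (T m) ≤ 2 ^ ℓ * P (U m)) :
    Tendsto (fun m => P (T m)) atTop (𝓝 0) := by
  have h : Tendsto (fun m => 2 ^ ℓ * P (V m)) atTop (𝓝 0) := by
    simpa using ENNReal.Tendsto.const_mul hV (.inr (ENNReal.pow_ne_top ENNReal.ofNat_ne_top))
  exact tendsto_of_tendsto_of_tendsto_of_le_of_le tendsto_const_nhds h (fun _ => zero_le)
    fun m => (hTU m).trans (mul_le_mul_right (measure_mono (hUV m)) _)

end MCGMT

/-- The problems form a sequence indexed by `m`; the `m`-th one has block dimensions `k m i` and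
`n m i`, which may vary with `m` in any way. -/
theorem theorem3 {Ω : Type*} [MeasurableSpace Ω] (P : Measure Ω) [IsProbabilityMeasure P]
    (ℓ : ℕ) (hℓ : 1 ≤ ℓ) (k n : ℕ → Fin ℓ → ℕ)
    (G : ∀ m, Ω → MCGMT.BlockMat (n m) (k m))
    (g : ∀ m, Ω → MCGMT.BlockVec (k m)) (h : ∀ m, Ω → MCGMT.BlockVec (n m))
    (hGauss : ∀ m, MCGMT.IsStdGaussian P (G m) (g m) (h m))
    (Sw : ∀ m, Set (MCGMT.BlockVec (k m))) (Su : ∀ m, Set (MCGMT.BlockVec (n m)))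
    (hSw_ne : ∀ m, (Sw m).Nonempty) (hSu_ne : ∀ m, (Su m).Nonempty)
    (hSw_convex : ∀ m, Convex ℝ (Sw m)) (hSu_convex : ∀ m, Convex ℝ (Su m))
    (hSw_compact : ∀ m, IsCompact (Sw m)) (hSu_compact : ∀ m, IsCompact (Su m))
    (ψ : ∀ m, MCGMT.BlockVec (k m) → MCGMT.BlockVec (n m) → ℝ)
    (hψ_cont : ∀ m, ContinuousOn (Function.uncurry (ψ m)) (Sw m ×ˢ Su m))
    (hψ_convex : ∀ m, ∀ u ∈ Su m, ConvexOn ℝ (Sw m) (fun w => ψ m w u))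
    (hψ_concave : ∀ m, ∀ w ∈ Sw m, ConcaveOn ℝ (Su m) (fun u => ψ m w u))
    (S : ∀ m, Set (MCGMT.BlockVec (k m))) (hS_open : ∀ m, IsOpen (S m))
    (φ φc ζ : ℝ)
    (hφ : TendstoInMeasure P
      (fun m ω => MCGMT.minMax (Sw m) (Su m) (MCGMT.aoCost (ψ m) (g m ω) (h m ω)))
      atTop (fun _ => φ))
    (hφc : TendstoInMeasure P
      (fun m ω => MCGMT.minMax (Sw m \ S m) (Su m) (MCGMT.aoCost (ψ m) (g m ω) (h m ω)))
      atTop (fun _ => φc))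
    (hζ : 0 < ζ) (hgap : φ + ζ ≤ φc) :
    TendstoInMeasure P
      (fun m ω => |MCGMT.minMax (Sw m) (Su m) (MCGMT.poCost (ψ m) (G m ω))
        - MCGMT.minMax (Sw m) (Su m) (MCGMT.aoCost (ψ m) (g m ω) (h m ω))|)
      atTop (fun _ => 0) ∧
    -- optimal solutions exist and all of them lie in `S`, with probability tending to one
    Tendsto (fun m => P {ω |
        (MCGMT.optSol (Sw m) (Su m) (MCGMT.poCost (ψ m) (G m ω))).Nonempty ∧
        MCGMT.optSol (Sw m) (Su m) (MCGMT.poCost (ψ m) (G m ω)) ⊆ S m})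
      atTop (𝓝 1) ∧
    -- hence so does any optimal solution `ŵ`, however selected
    ∀ ŵ : ∀ m, Ω → MCGMT.BlockVec (k m),
      (∀ m, ∀ᵐ ω ∂P, ŵ m ω ∈ MCGMT.optSol (Sw m) (Su m) (MCGMT.poCost (ψ m) (G m ω))) →
      Tendsto (fun m => P {ω | ŵ m ω ∈ S m}) atTop (𝓝 1) := by
  have hηs : ∀ η : ℝ, 0 < η →
      Tendsto (fun m => P {ω | MCGMT.minMax (Sw m) (Su m) (MCGMT.poCost (ψ m) (G m ω)) < φ - η})
        atTop (𝓝 0) ∧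
      Tendsto (fun m => P {ω | φ + η < MCGMT.minMax (Sw m) (Su m) (MCGMT.poCost (ψ m) (G m ω))})
        atTop (𝓝 0) := by
    intro η hη
    have hV := tendstoInMeasure_iff_dist.1 hφ η hη
    refine ⟨MCGMT.tendsto_measure_zero_of_le_two_pow_mul hV (fun m ω hω => ?_) fun m =>
      MCGMT.measure_minMax_poCost_lt_le (hGauss m) (hSw_ne m) (hSu_ne m) (hSw_compact m)
        (hSu_compact m) (hψ_cont m) _,
      MCGMT.tendsto_measure_zero_of_le_two_pow_mul hV (fun m ω hω => ?_) fun m =>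
      MCGMT.measure_lt_minMax_poCost_le (hGauss m) (hSw_ne m) (hSu_ne m) (hSw_compact m)
        (hSu_compact m) (hSw_convex m) (hSu_convex m) (hψ_cont m) (hψ_convex m)
        (hψ_concave m) _⟩
    · simp only [Set.mem_ofPred_eq] at hω ⊢
      rw [Real.dist_eq, le_abs]
      right; linarith
    · simp only [Set.mem_ofPred_eq] at hω ⊢
      rw [Real.dist_eq, le_abs]
      left; linarith
  have hconv : TendstoInMeasure P
      (fun m ω => |MCGMT.minMax (Sw m) (Su m) (MCGMT.poCost (ψ m) (G m ω))
        - MCGMT.minMax (Sw m) (Su m) (MCGMT.aoCost (ψ m) (g m ω) (h m ω))|)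
      atTop (fun _ => 0) := by
    rw [tendstoInMeasure_iff_dist]
    intro ε hε
    -- Off three rare events, both costs are within ε/3 of φ, hence less than ε apart.
    have hV := tendstoInMeasure_iff_dist.1 hφ (ε / 3) (by positivity)
    obtain ⟨h1, h2⟩ := hηs (ε / 3) (by positivity)
    have hsum := (hV.add h1).add h2
    simp only [add_zero] at hsum
    refine tendsto_of_tendsto_of_tendsto_of_le_of_le tendsto_const_nhds hsum
      (fun _ => zero_le) fun m => ?_
    refine (measure_mono fun ω hω => ?_).trans ((measure_union_le _ _).trans
      (add_le_add_left (measure_union_le _ _) _))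
    by_contra hcon
    simp only [Set.mem_union, Set.mem_ofPred_eq, not_or, not_le, not_lt, Real.dist_eq] at hcon hω
    obtain ⟨⟨h3, h4⟩, h5⟩ := hcon
    rw [abs_lt] at h3
    rw [sub_zero, abs_abs, le_abs] at hω
    rcases hω with hω | hω <;> linarith
  have hlim : Tendsto (fun m => P {ω |
        (MCGMT.optSol (Sw m) (Su m) (MCGMT.poCost (ψ m) (G m ω))).Nonempty ∧
        MCGMT.optSol (Sw m) (Su m) (MCGMT.poCost (ψ m) (G m ω)) ⊆ S m}) atTop (𝓝 1) := by
    refine MCGMT.tendsto_measure_one_of_compl ?_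
    have hV := tendstoInMeasure_iff_dist.1 hφc (ζ / 3) (by positivity)
    -- Over an empty set `minMax` takes the default value 0, which says nothing about the primary
    -- problem. Nonemptiness is therefore part of the event; an optimal solution outside S will
    -- witness it.
    have hc : Tendsto (fun m => P {ω | (Sw m \ S m).Nonempty ∧
        MCGMT.minMax (Sw m \ S m) (Su m) (MCGMT.poCost (ψ m) (G m ω)) < φc - ζ / 3})
        atTop (𝓝 0) := by
      refine MCGMT.tendsto_measure_zero_of_le_two_pow_mul (ℓ := ℓ)
        (U := fun m => {ω | MCGMT.minMax (Sw m \ S m) (Su m)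
          (MCGMT.aoCost (ψ m) (g m ω) (h m ω)) ≤ φc - ζ / 3}) hV (fun m ω hω => ?_) fun m => ?_
      · simp only [Set.mem_ofPred_eq] at hω ⊢
        rw [Real.dist_eq, le_abs]
        right; linarith
      · by_cases hne : (Sw m \ S m).Nonempty
        · simp only [hne, true_and]
          exact MCGMT.measure_minMax_poCost_lt_le (hGauss m) hne (hSu_ne m)
            ((hSw_compact m).diff (hS_open m)) (hSu_compact m)
            ((hψ_cont m).mono (Set.prod_mono Set.sdiff_subset subset_rfl)) _
        · simp [hne]
    have hsum := hc.add (hηs (ζ / 3) (by positivity)).2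
    simp only [add_zero] at hsum
    refine tendsto_of_tendsto_of_tendsto_of_le_of_le tendsto_const_nhds hsum
      (fun _ => zero_le) fun m => ?_
    refine (measure_mono fun ω hω => ?_).trans (measure_union_le _ _)
    have hF := MCGMT.continuousOn_poCost (hψ_cont m) (G m ω)
    have hne := MCGMT.optSol_nonempty (hSw_ne m) (hSw_compact m) (hSu_compact m) hF
    have hns : ¬ MCGMT.optSol (Sw m) (Su m) (MCGMT.poCost (ψ m) (G m ω)) ⊆ S m :=
      fun hs => hω ⟨hne, hs⟩
    obtain ⟨w, hw, hwS⟩ := Set.not_subset.1 hns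
    have h1 := MCGMT.iSup_eq_minMax_of_mem_optSol (hSw_compact m) (hSu_compact m) hF hw
    have h2 := MCGMT.minMax_le_iSup ((hSw_compact m).diff (hS_open m)) (hSu_compact m)
      (hF.mono (Set.prod_mono Set.sdiff_subset subset_rfl))
      (w := w) ⟨hw.1, hwS⟩
    -- An optimal w outside S would give φc − ζ/3 ≤ min over `Sw \ S` ≤ Φ ≤ φ + ζ/3, contradicting
    -- the gap ζ.
    by_contra hcon
    simp only [Set.mem_union, Set.mem_ofPred_eq, not_or, not_and, not_lt] at hcon
    have h3 := hcon.1 ⟨w, hw.1, hwS⟩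
    linarith [hcon.2]
  refine ⟨hconv, hlim, fun ŵ hŵ => ?_⟩
  refine tendsto_of_tendsto_of_tendsto_of_le_of_le hlim tendsto_const_nhds (fun m => ?_)
    fun m => prob_le_one
  refine measure_mono_ae ?_
  filter_upwards [hŵ m] with ω hω hsub
  exact hsub.2 hω
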